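/- Setting. Let $0<\alpha<1$, $T>0$, let $\Omega\subset\mathbb{R}^d$ be open (in particular, any bounded Lipschitz domain with $d\in\{1,2,3\}$ is allowed), and let $\|\cdot\|$ and $\langle\cdot,\cdot\rangle$ be the norm and inner product (extended to the duality pairing) of $L_2(\Omega)$. Let $\mathcal L v=-\sum_{i,j}\partial_i(a_{ij}\partial_j v)-\sum_i\partial_i(p_i v)+\sum_i b_i\,\partial_i v+cv$ be a uniformly elliptic operator with coefficients in $L_\infty(\Omega)$ such that, for some $\lambda\in\mathbb{R}$, $\langle\mathcal L v,v\rangle\ge\lambda\|v\|^2$ for all $v\in H^1_0(\Omega)$. For a function $v$ of $t$ and $t>0$ the Caputo derivative is $$D_t^\alpha v(t)=\frac1{\Gamma(1-\alpha)}\int_0^t(t-s)^{-\alpha}\,\partial_sv(s)\,ds:=\frac1{\Gamma(1-\alpha)}\lim_{\varepsilon\to0^+}\Bigl\{t^{-\alpha}[v(\varepsilon)-v(0)]+\int_\varepsilon^t(t-s)^{-\alpha}\,\partial_sv(s)\,ds\Bigr\},$$ with $v$ locally absolutely continuous on $(0,t]$ (thus the integral is improper at $0$, and a jump of $v$ at $t=0$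 contributes a multiple of the Dirac delta-function to $\partial_s v$; the term $t^{-\alpha}[v(\varepsilon)-v(0)]$ vanishes in the limit if $v$ is right-continuous at $0$). Let $f(\cdot,t)\in L_{1,\mathrm{loc}}(\Omega)$ for $0<t\le T$ and $u_0\in L_2(\Omega)$. Let $u$ be a solution of $D_t^\alpha u+\mathcal L u=f$ for $0<t\le T$ (in the sense of distributions on $\Omega$ for each $t$) with $u(\cdot,0)=u_0$. Let $u$ and its approximation $u_h$ be in $L_\infty(0,t;L_2(\Omega))\cap W^{1,\infty}(\epsilon,t;L_2(\Omega))$ for any $0<\epsilon<t\le T$, and also in $H_0^1(\Omega)$ for each $0<t\le T$. Suppose that $u_h:[0,T]\to L_2(\Omega)$ is continuous; it is not required that $u_h(\cdot,0)=u_0$. Suppose that for $0<t\le T$ the modified residual $$R_h(\cdot,t)=[u_h(\cdot,0)-u_0]\,\frac{t^{-\alpha}}{\Gamma(1-\alpha)}+(D_t^\alpha+\mathcal L)u_h(\cdot,t)-f(\cdot,t)$$ is in $L_2(\Omega)$, and set $e:=u_h-u$. Then the following hold. (i) For all $0<t\le T$, $$\|e(\cdot,t)\|\le(D_t^\alpha+\lambda)^{-1}\|R_h(\cdot,t)\|:=\int_0^t(t-s)^{\alpha-1}E_{\alpha,\alpha}(-\lambda[t-s]^\alpha)\,\|R_h(\cdot,s)\|\,ds,\qquad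 E_{\alpha,\beta}(s)=\sum_{k=0}^\infty\frac{s^k}{\Gamma(\alpha k+\beta)},$$ where the integral, whose integrand is non-negative, may equal $+\infty$. (ii) If $\mathcal E:[0,T]\to[0,\infty)$ is such that $D_t^\alpha\mathcal E(t)$ exists and $\|R_h(\cdot,t)\|\le(D_t^\alpha+\lambda)\mathcal E(t)$ for all $0<t\le T$, then $\|e(\cdot,t)\|\le\mathcal E(t)$ for all $0<t\le T$; this bound holds also at $t=0$ if $\mathcal E$ and $u$ are right-continuous at $0$. (iii) If $\lambda\ge0$, then for every $\tau>0$ and all $0<t\le T$ (with suprema in $[0,\infty]$) $$\|e(\cdot,t)\|\le\sup_{0<s\le t}\frac{\|R_h(\cdot,s)\|}{\mathcal R_0(s)},\qquad \|e(\cdot,t)\|\le t^{\alpha-1}\sup_{0<s\le t}\frac{\|R_h(\cdot,s)\|}{\mathcal R_1(s)},\qquad \|e(\cdot,t)\|\le\mathcal E_1(t)\sup_{0<s\le t}\frac{\|R_h(\cdot,s)\|}{\mathcal R_1(s)},$$ where, with $\beta:=1-\alpha$ and $v^+:=\max\{0,v\}$, $\mathcal R_0(t)=\frac{t^{-\alpha}}{\Gamma(1-\alpha)}+\lambda$,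 $\mathcal R_1(t)=\frac{t^{-1}\rho(\tau/t)}{\Gamma(1-\alpha)}+\lambda\,\mathcal E_1(t)$, $\mathcal E_1(t)=\max\{\tau,t\}^{\alpha-1}$, and $\rho(s)=s^{-\beta}[1-((1-s)^+)^\beta]\ge s^{-\beta}\min\{\beta s,1\}$ for $s>0$. -/

import Mathlib

open Set Filter Topology MeasureTheory
open scoped ENNReal ContDiff

noncomputable section

namespace FracParabolic

/-! ### Functions of time with values in a normed space -/

section Time

variable {X : Type*} [NormedAddCommGroup X] [NormedSpace ℝ X]

/-- On `[a, b]` the function `v` is absolutely continuous, with (weak) derivative `g ∈ L¹(a, b; X)`. -/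
def HasTimeDeriv (v g : ℝ → X) (a b : ℝ) : Prop :=
  IntervalIntegrable g volume a b ∧ ∀ s ∈ Icc a b, v s = v a + ∫ r in a..s, g r

/-- `v ∈ W^{1,∞}(a, b; X)` (`v` being the continuous representative): the derivative is in
`L_∞(a, b; X)`. -/
def MemW1Inf (v : ℝ → X) (a b : ℝ) : Prop :=
  ∃ g : ℝ → X, MemLp g ∞ (volume.restrict (Ioo a b)) ∧ HasTimeDeriv v g a b

/-- `v ∈ L_∞(0, t; X) ∩ W^{1,∞}(ε, t; X)` for any `0 < ε < t ≤ T`. -/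
def TimeRegular (T : ℝ) (v : ℝ → X) : Prop :=
  ∀ ε t : ℝ, 0 < ε → ε < t → t ≤ T →
    MemLp v ∞ (volume.restrict (Ioo 0 t)) ∧ MemW1Inf v ε t

/-- The Caputo derivative `D_t^α v (t) = Γ(1-α)⁻¹ ∫_0^t (t-s)^{-α} ∂_s v(s) ds` exists and equals `w`.

Here `∂_s v` is the distributional derivative, which on `(0, t]` is a function `g`. Since `g` need
not be integrable near `0`, the integral is improper at `0`; a jump of `v` at the initial
time contributes `t^{-α} (v(0+) - v(0))`, as `∂_s v` then contains `(v(0+) - v(0)) δ(s)`. If `v` is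
right-continuous at `0`, the term `t^{-α} (v(ε) - v(0))` vanishes in the limit; if moreover
`(t-s)^{-α} g(s)` is integrable on `(0, t)`, the limit is the Lebesgue integral. -/
def HasCaputoDerivAt (α : ℝ) (v : ℝ → X) (t : ℝ) (w : X) : Prop :=
  ∃ g : ℝ → X,
    (∀ ε ∈ Ioo 0 t, HasTimeDeriv v g ε t ∧
      IntervalIntegrable (fun s => (t - s) ^ (-α) • g s) volume ε t) ∧
    Tendsto (fun ε : ℝ => (Real.Gamma (1 - α))⁻¹ •
        (t ^ (-α) • (v ε - v 0) + ∫ s in ε..t, (t - s) ^ (-α) • g s))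
      (𝓝[>] 0) (𝓝 w)

end Time

/-! ### The operator `(D_t^α + μ)⁻¹` and the residual barriers -/

/-- The generalized Mittag-Leffler function `E_{α,β}(s) = ∑_k s^k / Γ(α k + β)`. -/
def mittagLeffler (α β s : ℝ) : ℝ :=
  ∑' k : ℕ, (Real.Gamma (α * k + β))⁻¹ * s ^ k

/-- `(D_t^α + μ)⁻¹ v (t) = ∫_0^t (t-s)^{α-1} E_{α,α}(-μ (t-s)^α) v(s) ds` for `v ≥ 0`, as a
Lebesgue integral with values in `[0, ∞]` (the kernel is positive for `0 < α < 1`). -/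
def caputoInv (α μ : ℝ) (v : ℝ → ℝ≥0∞) (t : ℝ) : ℝ≥0∞ :=
  ∫⁻ s in Ioo 0 t,
    ENNReal.ofReal ((t - s) ^ (α - 1) * mittagLeffler α α (-μ * (t - s) ^ α)) * v s

/-- `R₀(t) = t^{-α} / Γ(1-α) + μ`. -/
def barrierR0 (α μ t : ℝ) : ℝ := (Real.Gamma (1 - α))⁻¹ * t ^ (-α) + μ

/-- `E₁(t) = max{τ, t}^{α-1}`. -/
def barrierE1 (α τ t : ℝ) : ℝ := max τ t ^ (α - 1)

/-- `ρ(s) = s^{-β} [1 - ((1-s)^+)^β]`, `β = 1 - α`. -/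
def barrierRho (α s : ℝ) : ℝ := s ^ (-(1 - α)) * (1 - max 0 (1 - s) ^ (1 - α))

/-- `R₁(t) = t^{-1} ρ(τ/t) / Γ(1-α) + μ E₁(t)`. -/
def barrierR1 (α μ τ t : ℝ) : ℝ :=
  (Real.Gamma (1 - α))⁻¹ * t⁻¹ * barrierRho α (τ / t) + μ * barrierE1 α τ t

/-! ### Function spaces on `Ω ⊆ ℝ^d` and elliptic operators -/

/-- `ℝ^d` with the Euclidean norm. -/
abbrev Space (d : ℕ) : Type := EuclideanSpace ℝ (Fin d)

variable {d : ℕ}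

/-- `L_2(Ω)`. -/
abbrev L2 (Ω : Set (Space d)) : Type := Lp ℝ 2 (volume.restrict Ω)

/-- `L_2(Ω)^d`. -/
abbrev L2Vec (Ω : Set (Space d)) : Type := Lp (Space d) 2 (volume.restrict Ω)

/-- `φ ∈ C_c^∞(Ω)`. -/
def IsTestFunction (Ω : Set (Space d)) (φ : Space d → ℝ) : Prop :=
  ContDiff ℝ ∞ φ ∧ HasCompactSupport φ ∧ tsupport φ ⊆ Ω

/-- The pairs `(v, ∇v)` with `v ∈ H^1_0(Ω)`: the space `H^1_0(Ω)` is the closure of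
`C_c^∞(Ω)` in the norm of `H^1(Ω)`, i.e. with respect to `L_2` convergence of functions and
gradients. -/
def H10Graph (Ω : Set (Space d)) : Set (L2 Ω × L2Vec Ω) :=
  closure {p | ∃ φ : Space d → ℝ, IsTestFunction Ω φ ∧
    p.1 =ᵐ[volume.restrict Ω] φ ∧ p.2 =ᵐ[volume.restrict Ω] gradient φ}

/-- A linear second-order uniformly elliptic operator
`ℒ v = - ∑ᵢⱼ ∂ᵢ(aᵢⱼ ∂ⱼ v) - ∑ᵢ ∂ᵢ(pᵢ v) + ∑ᵢ bᵢ ∂ᵢ v + c v` in `Ω` with coefficients in `L_∞(Ω)`. -/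
structure EllipticOperator (Ω : Set (Space d)) where
  a : Space d → Fin d → Fin d → ℝ
  p : Space d → Fin d → ℝ
  b : Space d → Fin d → ℝ
  c : Space d → ℝ
  a_mem : ∀ i j, MemLp (fun x => a x i j) ∞ (volume.restrict Ω)
  p_mem : ∀ i, MemLp (fun x => p x i) ∞ (volume.restrict Ω)
  b_mem : ∀ i, MemLp (fun x => b x i) ∞ (volume.restrict Ω)
  c_mem : MemLp c ∞ (volume.restrict Ω)
  elliptic : ∃ θ : ℝ, 0 < θ ∧ ∀ᵐ x ∂(volume.restrict Ω), ∀ ξ : Space d,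
    θ * ‖ξ‖ ^ 2 ≤ ∑ i, ∑ j, a x i j * ξ j * ξ i

/-- The pairing `⟨ℒ v, w⟩`, where `V = ∇v` and `W = ∇w`. -/
def EllipticOperator.pairing {Ω : Set (Space d)} (L : EllipticOperator Ω)
    (v : Space d → ℝ) (V : Space d → Space d) (w : Space d → ℝ) (W : Space d → Space d) : ℝ :=
  ∫ x in Ω, ((∑ i, ∑ j, L.a x i j * V x j * W x i) + (∑ i, L.p x i * v x * W x i)
    + (∑ i, L.b x i * V x i * w x) + L.c x * v x * w x)

/-- `⟨ℒ v, v⟩ ≥ μ ‖v‖²` for all `v ∈ H^1_0(Ω)`. -/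
def EllipticOperator.LowerBound {Ω : Set (Space d)} (L : EllipticOperator Ω) (μ : ℝ) : Prop :=
  ∀ (v : L2 Ω) (V : L2Vec Ω), (v, V) ∈ H10Graph Ω → μ * ‖v‖ ^ 2 ≤ L.pairing v V v V

/-- `u` solves `D_t^α u + ℒ u = f` in `Ω × (0, T]` (in the sense of distributions on `Ω` for each
`t`), with `u(·, t) ∈ H^1_0(Ω)` for `t > 0` and `u(·, 0) = u₀`. -/
def IsSolution (Ω : Set (Space d)) (L : EllipticOperator Ω) (α T : ℝ)
    (f : ℝ → Space d → ℝ) (u₀ : L2 Ω) (u : ℝ → L2 Ω) : Prop :=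
  u 0 = u₀ ∧ ∀ t ∈ Ioc 0 T, ∃ (U : L2Vec Ω) (Du : L2 Ω),
    (u t, U) ∈ H10Graph Ω ∧ HasCaputoDerivAt α u t Du ∧
    ∀ φ : Space d → ℝ, IsTestFunction Ω φ →
      (∫ x in Ω, Du x * φ x) + L.pairing (u t) U φ (gradient φ) = ∫ x in Ω, f t x * φ x

/-- `u_h(·, t) ∈ H^1_0(Ω)` for `t > 0`, and the functions `R(·, t) ∈ L_2(Ω)`, `0 < t ≤ T`, are the
residual of `u_h`, corrected for the initial error:
`R(·,t) = [u_h(·,0) - u₀] t^{-α} / Γ(1-α) + (D_t^α + ℒ) u_h(·,t) - f(·,t)` in the sense of distributions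
on `Ω`. -/
def IsModifiedResidual (Ω : Set (Space d)) (L : EllipticOperator Ω) (α T : ℝ)
    (f : ℝ → Space d → ℝ) (u₀ : L2 Ω) (uh R : ℝ → L2 Ω) : Prop :=
  ∀ t ∈ Ioc 0 T, ∃ (U : L2Vec Ω) (Duh : L2 Ω),
    (uh t, U) ∈ H10Graph Ω ∧ HasCaputoDerivAt α uh t Duh ∧
    ∀ φ : Space d → ℝ, IsTestFunction Ω φ →
      ∫ x in Ω, R t x * φ x =
        (∫ x in Ω, (uh 0 x - u₀ x) * (Real.Gamma (1 - α))⁻¹ * t ^ (-α) * φ x)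
          + (∫ x in Ω, Duh x * φ x) + L.pairing (uh t) U φ (gradient φ)
          - ∫ x in Ω, f t x * φ x

end FracParabolic

end

namespace FracParabolic

/-! ### Mittag-Leffler functions and the kernel of the fractional resolvent -/

/-! The proof reduces the parabolic problem to a scalar fractional inequality for `‖e‖` and then
inverts the scalar operator with a positive kernel.

Subtracting the two weak formulations and testing with `e(t)`, which lies in `H¹₀`, gives `⟨D_t^α e
+ e(0) t^{-α}/Γ(1-α), e⟩ + μ‖e‖² ≤ ‖R‖‖e‖` (`IsModifiedResidual.exists_energy_le`). The correction
in the modified residual cancels the initial value inside the Caputo derivative, so `e` is treated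
as if it started from `0`. For fixed `s`, the function `r ↦ ‖e(s)‖‖e(r)‖ - ⟨e(s), e(r)⟩` is
non-negative and vanishes at `r = s`, and the Caputo derivative is non-positive at a zero minimum.
Hence `‖e‖ D_t^α‖e‖` is at most the inner product above, and after division by `‖e‖` one has `(D_t^α
+ μ)‖e‖ ≤ ‖R‖`.

Since `‖e‖` is Lipschitz only away from `t = 0`, this is proved for the operator truncated to `[ε,
∞)`, at the price of an error `C (h(s-ε) - h(s))`, where `h(x) = x^{-α}/Γ(1-α) + μ` and `C` bounds
`‖e‖` (`truncatedOp_norm_le`).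

The inverse has the kernel `k(x) = x^{α-1} E_{α,α}(-μ x^α)`. The convolution of `k` and `h` is `1`,
so integrating the truncated operator against `k(t-s)` over `[ε, t]` returns the value at `t`
exactly (`integral_fracKernel_mul_truncatedOp`). Positivity of `k` (`fracKernel_pos`) preserves
inequalities, and the truncation error vanishes as `ε → 0`. This yields (i). For (ii) the barrier is
treated in the same way: truncating a non-negative function only increases its Caputo derivative.
For (iii) the barriers are a constant and `E₁`, multiplied by the supremum and set to `0` at `t =
0`; the jump there produces the singular parts of `R₀` and `R₁`. -/

/-- Restrict Euler's integral to `(M, M+1]`. With `M` arbitrary, `Γ` outgrows every exponential,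
which is all that the convergence of the Mittag-Leffler series needs. -/
theorem rpow_mul_le_Gamma {y M : ℝ} (hy : 0 < y) (hM : 1 ≤ M) :
    M ^ y * (Real.exp (-(M + 1)) / (M + 1)) ≤ Real.Gamma y := by
  have hM0 : 0 < M := by linarith
  rw [Real.Gamma_eq_integral hy]
  have hint := Real.GammaIntegral_convergent hy
  have hsub : Ioc M (M + 1) ⊆ Ioi 0 := fun x hx => hM0.trans hx.1
  calc M ^ y * (Real.exp (-(M + 1)) / (M + 1))
      = ∫ x in Ioc M (M + 1), M ^ y * (Real.exp (-(M + 1)) / (M + 1)) := by simp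
    _ ≤ ∫ x in Ioc M (M + 1), Real.exp (-x) * x ^ (y - 1) := by
        refine setIntegral_mono_on (integrableOn_const (by simp)) (hint.mono_set hsub)
          measurableSet_Ioc fun x hx => ?_
        have hx0 : 0 < x := hM0.trans hx.1
        rw [Real.rpow_sub_one hx0.ne', mul_comm, div_mul_eq_mul_div, mul_div_assoc]
        have h1 : M ^ y ≤ x ^ y := Real.rpow_le_rpow hM0.le hx.1.le hy.le
        have h2 : Real.exp (-(M + 1)) ≤ Real.exp (-x) := Real.exp_le_exp.2 (by linarith [hx.2])
        have h3 : M ^ y / (M + 1) ≤ x ^ y / x := by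
          gcongr
          exact hx.2
        gcongr
    _ ≤ ∫ x in Ioi 0, Real.exp (-x) * x ^ (y - 1) := by
        refine setIntegral_mono_set hint ?_ hsub.eventuallyLE
        filter_upwards [ae_restrict_mem measurableSet_Ioi] with x hx
        have : (0 : ℝ) < x := hx
        positivity

theorem summable_mittagLeffler {α β : ℝ} (hα : 0 < α) (hβ : 0 < β) (s : ℝ) :
    Summable fun k : ℕ => (Real.Gamma (α * k + β))⁻¹ * s ^ k := by
  -- This choice of `M` makes the ratio `|s| / M ^ α` of the dominating geometric series at most
  -- `1/2`.
  obtain ⟨M, hM1, hM⟩ : ∃ M : ℝ, 1 ≤ M ∧ 2 * |s| ≤ M ^ α :=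
    ((eventually_ge_atTop 1).and
      ((tendsto_rpow_atTop hα).eventually_ge_atTop (2 * |s|))).exists
  have hM0 : 0 < M := by linarith
  set C : ℝ := Real.exp (-(M + 1)) / (M + 1) with hC
  have hC0 : 0 < C := by positivity
  have hq : |s| / M ^ α < 1 := by
    have : 0 < M ^ α := by positivity
    rw [div_lt_one this]
    rcases (abs_nonneg s).eq_or_lt with h | h <;> linarith
  refine Summable.of_norm_bounded
    ((summable_geometric_of_lt_one (by positivity) hq).mul_left (M ^ β * C)⁻¹) fun k => ?_
  have hy : 0 < α * k + β := by positivity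
  have hG := rpow_mul_le_Gamma hy hM1
  have hGp := Real.Gamma_pos_of_pos hy
  rw [norm_mul, norm_pow, Real.norm_eq_abs, Real.norm_eq_abs, abs_of_pos (inv_pos.2 hGp), div_pow,
    ← Real.rpow_mul_natCast hM0.le]
  calc (Real.Gamma (α * k + β))⁻¹ * |s| ^ k ≤ (M ^ (α * k + β) * C)⁻¹ * |s| ^ k := by
        gcongr
    _ = _ := by
        rw [Real.rpow_add hM0]
        field_simp

theorem mittagLeffler_zero {α β : ℝ} : mittagLeffler α β 0 = (Real.Gamma β)⁻¹ := by
  rw [mittagLeffler, tsum_eq_single 0]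
  · simp
  · intro k hk
    simp [hk]

theorem continuous_mittagLeffler {α β : ℝ} (hα : 0 < α) (hβ : 0 < β) :
    Continuous (mittagLeffler α β) := by
  rw [continuous_iff_continuousAt]
  intro s
  have h : ContinuousOn (mittagLeffler α β) (Icc (-(|s| + 1)) (|s| + 1)) := by
    refine continuousOn_tsum (fun k => by fun_prop) (summable_mittagLeffler hα hβ (|s| + 1))
      fun k x hx => ?_
    have hGp := Real.Gamma_pos_of_pos (show 0 < α * k + β by positivity)
    rw [norm_mul, norm_pow, Real.norm_eq_abs, Real.norm_eq_abs, abs_of_pos (inv_pos.2 hGp)]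
    gcongr
    exact abs_le.2 hx
  exact h.continuousAt (Icc_mem_nhds (by linarith [neg_abs_le s]) (by linarith [le_abs_self s]))

/-- The kernel `x ^ (β - 1) * E_{α,β}(c x ^ α)`. -/
noncomputable def fracKernel (α β c x : ℝ) : ℝ := x ^ (β - 1) * mittagLeffler α β (c * x ^ α)

/-- Split off the term `k = 0` of the series. -/
theorem fracKernel_succ {α β c x : ℝ} (hα : 0 < α) (hβ : 0 < β) (hx : 0 < x) :
    fracKernel α β c x = (Real.Gamma β)⁻¹ * x ^ (β - 1) + c * fracKernel α (β + α) c x := by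
  rw [fracKernel, fracKernel, mittagLeffler, (summable_mittagLeffler hα hβ _).tsum_eq_zero_add,
    mittagLeffler]
  have h : x ^ (β + α - 1) = x ^ (β - 1) * x ^ α := by
    rw [← Real.rpow_add hx]
    ring_nf
  have h2 : ∀ k : ℕ, (Real.Gamma (α * (k + 1 : ℕ) + β))⁻¹ * (c * x ^ α) ^ (k + 1) =
      (c * x ^ α) * ((Real.Gamma (α * k + (β + α)))⁻¹ * (c * x ^ α) ^ k) := by
    intro k
    rw [pow_succ]
    push_cast
    ring_nf
  simp_rw [h2]
  rw [tsum_mul_left, h]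
  simp only [CharP.cast_eq_zero, mul_zero, zero_add, pow_zero, mul_one]
  ring

theorem continuousOn_fracKernel {α β c : ℝ} (hα : 0 < α) (hβ : 0 < β) :
    ContinuousOn (fracKernel α β c) (Ioi 0) := by
  refine ContinuousOn.mul ?_ ((continuous_mittagLeffler hα hβ).comp_continuousOn ?_)
  · exact fun x hx => (Real.continuousAt_rpow_const x _ (Or.inl (ne_of_gt hx))).continuousWithinAt
  · exact (continuous_const.mul (Real.continuous_rpow_const hα.le)).continuousOn

/-! ### Beta integrals and fractional integration of the kernel -/

theorem intervalIntegrable_sub_rpow {p a t : ℝ} (hp : -1 < p) :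
    IntervalIntegrable (fun s => (t - s) ^ p) volume a t := by
  simpa using (intervalIntegral.intervalIntegrable_rpow' (a := t - a) (b := 0) hp).comp_sub_left t

theorem integral_rpow_mul_sub_rpow {a b x : ℝ} (ha : 0 < a) (hb : 0 < b) (hx : 0 < x) :
    ∫ y in 0..x, (x - y) ^ (a - 1) * y ^ (b - 1) =
      x ^ (a + b - 1) * (Real.Gamma a * Real.Gamma b / Real.Gamma (a + b)) := by
  have h := Complex.betaIntegral_scaled b a hx
  rw [Complex.betaIntegral_eq_Gamma_mul_div _ _ (by simpa) (by simpa), ← Complex.ofReal_add,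
    Complex.Gamma_ofReal, Complex.Gamma_ofReal, Complex.Gamma_ofReal] at h
  have h2 : ∫ y in 0..x, (y : ℂ) ^ ((b : ℂ) - 1) * ((x : ℂ) - y) ^ ((a : ℂ) - 1) =
      ∫ y in 0..x, (((x - y) ^ (a - 1) * y ^ (b - 1) : ℝ) : ℂ) := by
    refine intervalIntegral.integral_congr fun y hy => ?_
    rw [uIcc_of_le hx.le] at hy
    have e1 : ((b : ℂ) - 1) = ((b - 1 : ℝ) : ℂ) := by push_cast; rfl
    have e2 : ((a : ℂ) - 1) = ((a - 1 : ℝ) : ℂ) := by push_cast; rfl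
    rw [e1, e2, ← Complex.ofReal_sub, ← Complex.ofReal_cpow hy.1,
      ← Complex.ofReal_cpow (sub_nonneg.2 hy.2), ← Complex.ofReal_mul, mul_comm]
  rw [h2, intervalIntegral.integral_ofReal] at h
  have e3 : (((b + a : ℝ) : ℂ) - 1) = ((b + a - 1 : ℝ) : ℂ) := by push_cast; rfl
  rw [e3, ← Complex.ofReal_cpow hx.le] at h
  have h3 := (by exact_mod_cast h : ∫ y in 0..x, (x - y) ^ (a - 1) * y ^ (b - 1) =
    x ^ (b + a - 1) * (Real.Gamma b * Real.Gamma a / Real.Gamma (b + a)))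
  rw [h3, add_comm b a, mul_comm (Real.Gamma b)]

theorem intervalIntegrable_rpow_mul_sub_rpow {a b x : ℝ} (ha : 0 < a) (hb : 0 < b) (hx : 0 < x) :
    IntervalIntegrable (fun y => (x - y) ^ (a - 1) * y ^ (b - 1)) volume 0 x := by
  -- A non-integrable function has integral `0` by convention, so the non-zero Beta value already
  -- proves integrability.
  refine intervalIntegral.intervalIntegrable_of_integral_ne_zero ?_
  rw [integral_rpow_mul_sub_rpow ha hb hx]
  have := Real.Gamma_pos_of_pos ha
  have := Real.Gamma_pos_of_pos hb
  have := Real.Gamma_pos_of_pos (add_pos ha hb)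
  positivity

theorem intervalIntegrable_rpow_mul_fracKernel {α β a c x : ℝ} (hα : 0 < α) (hβ : 0 < β)
    (ha : 0 < a) (hx : 0 < x) :
    IntervalIntegrable (fun y => (x - y) ^ (a - 1) * fracKernel α β c y) volume 0 x := by
  have h := (intervalIntegrable_rpow_mul_sub_rpow ha hβ hx).mul_continuousOn
    (g := fun y => mittagLeffler α β (c * y ^ α))
    ((continuous_mittagLeffler hα hβ).comp
      (continuous_const.mul (Real.continuous_rpow_const hα.le))).continuousOn
  refine h.congr fun y _ => ?_
  simp only [fracKernel]
  ring

/-- Fractional integration of order `a` raises the second index from `β` to `a + β`: each term of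
the series is a Beta integral. -/
theorem integral_rpow_mul_fracKernel {α β a c x : ℝ} (hα : 0 < α) (hβ : 0 < β)
    (ha : 0 < a) (hx : 0 < x) :
    ∫ y in 0..x, (x - y) ^ (a - 1) * fracKernel α β c y =
      Real.Gamma a * fracKernel α (a + β) c x := by
  let F (k : ℕ) (y : ℝ) : ℝ :=
    (Real.Gamma (α * k + β))⁻¹ * c ^ k * ((x - y) ^ (a - 1) * y ^ (α * k + β - 1))
  have hpos (k : ℕ) : 0 < α * k + β := by positivity
  have hI (k : ℕ) : ∫ y in 0..x, (x - y) ^ (a - 1) * y ^ (α * k + β - 1) =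
      x ^ (a + β - 1) * (Real.Gamma a * Real.Gamma (α * k + β) / Real.Gamma (α * k + (a + β))) *
        (x ^ α) ^ k := by
    rw [integral_rpow_mul_sub_rpow ha (hpos k) hx, ← Real.rpow_mul_natCast hx.le, mul_right_comm,
      ← Real.rpow_add hx]
    ring_nf
  have hint (k : ℕ) : Integrable (F k) (volume.restrict (Ioc 0 x)) :=
    ((intervalIntegrable_rpow_mul_sub_rpow ha (hpos k) hx).const_mul _).1
  -- Here `c` is a fresh variable: the identity is used with `|c|` for the norms and with the
  -- original `c` for the values.
  have hval (c : ℝ) (k : ℕ) : (Real.Gamma (α * k + β))⁻¹ * c ^ k *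
      (∫ y in 0..x, (x - y) ^ (a - 1) * y ^ (α * k + β - 1)) =
      Real.Gamma a * (x ^ (a + β - 1) *
        ((Real.Gamma (α * k + (a + β)))⁻¹ * (c * x ^ α) ^ k)) := by
    have := (Real.Gamma_pos_of_pos (hpos k)).ne'
    rw [hI, mul_pow]
    field_simp
  have hsum : Summable fun k => ∫ y in Ioc 0 x, ‖F k y‖ := by
    have h := ((summable_mittagLeffler hα (add_pos ha hβ) (|c| * x ^ α)).mul_left
      (x ^ (a + β - 1))).mul_left (Real.Gamma a)
    refine h.congr fun k => ?_
    rw [← hval, ← intervalIntegral.integral_const_mul, intervalIntegral.integral_of_le hx.le]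
    refine setIntegral_congr_fun measurableSet_Ioc fun y hy => ?_
    have h1 : 0 ≤ (x - y) ^ (a - 1) := Real.rpow_nonneg (sub_nonneg.2 hy.2) _
    have h2 : 0 ≤ y ^ (α * k + β - 1) := Real.rpow_nonneg hy.1.le _
    have h3 := Real.Gamma_pos_of_pos (hpos k)
    simp only [F, norm_mul, norm_inv, norm_pow, Real.norm_eq_abs, abs_of_nonneg h1,
      abs_of_nonneg h2, abs_of_pos h3]
  have h := (hasSum_integral_of_summable_integral_norm hint hsum).tsum_eq
  have hL : ∫ y in Ioc 0 x, ∑' k, F k y = ∫ y in 0..x, (x - y) ^ (a - 1) * fracKernel α β c y := by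
    rw [intervalIntegral.integral_of_le hx.le]
    refine setIntegral_congr_fun measurableSet_Ioc fun y hy => ?_
    simp only [F, fracKernel, mittagLeffler]
    rw [← tsum_mul_left, ← tsum_mul_left]
    refine tsum_congr fun k => ?_
    have : y ^ (α * k + β - 1) = y ^ (β - 1) * (y ^ α) ^ k := by
      rw [← Real.rpow_mul_natCast hy.1.le, ← Real.rpow_add hy.1]
      ring_nf
    rw [this, mul_pow]
    ring
  rw [← hL, ← h, fracKernel, mittagLeffler, ← tsum_mul_left, ← tsum_mul_left]
  refine tsum_congr fun k => ?_
  rw [← hval, ← intervalIntegral.integral_const_mul, intervalIntegral.integral_of_le hx.le]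

/-- The kernel of `D_t^α + μ` acting on derivatives: for absolutely continuous `v` with `v(0) = 0`,
`(D_t^α + μ) v` is the convolution of `resolventSymbol α μ` with `v'`. -/
noncomputable def resolventSymbol (α μ x : ℝ) : ℝ := (Real.Gamma (1 - α))⁻¹ * x ^ (-α) + μ

theorem intervalIntegrable_resolventSymbol_mul_fracKernel {α μ x : ℝ} (hα0 : 0 < α) (hα1 : α < 1)
    (hx : 0 < x) : IntervalIntegrable
      (fun y => resolventSymbol α μ (x - y) * fracKernel α α (-μ) y) volume 0 x := by
  have h1 := intervalIntegrable_rpow_mul_fracKernel (c := -μ) hα0 hα0 (sub_pos.2 hα1) hx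
  have h2 := intervalIntegrable_rpow_mul_fracKernel (c := -μ) hα0 hα0 one_pos hx
  refine ((h1.const_mul (Real.Gamma (1 - α))⁻¹).add (h2.const_mul μ)).congr fun y _ => ?_
  simp only [resolventSymbol, sub_self, Real.rpow_zero, one_mul, sub_sub_cancel_left]
  ring

/-- The two parts of the symbol are fractional integrations of orders `1 - α` and `1`; they turn the
second index `α` into `1` and `1 + α`. By `fracKernel_succ` these two kernels differ by the constant
`1` once weighted by `μ`. -/
theorem integral_resolventSymbol_mul_fracKernel {α μ x : ℝ} (hα0 : 0 < α) (hα1 : α < 1)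
    (hx : 0 < x) :
    ∫ y in 0..x, resolventSymbol α μ (x - y) * fracKernel α α (-μ) y = 1 := by
  have hβ : 0 < 1 - α := sub_pos.2 hα1
  have h1 := intervalIntegrable_rpow_mul_fracKernel (c := -μ) hα0 hα0 hβ hx
  have h2 := intervalIntegrable_rpow_mul_fracKernel (c := -μ) hα0 hα0 one_pos hx
  have h3 : ∀ y, resolventSymbol α μ (x - y) * fracKernel α α (-μ) y =
      (Real.Gamma (1 - α))⁻¹ * ((x - y) ^ (1 - α - 1) * fracKernel α α (-μ) y) +
        μ * ((x - y) ^ ((1 : ℝ) - 1) * fracKernel α α (-μ) y) := by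
    intro y
    simp only [resolventSymbol, sub_self, Real.rpow_zero, one_mul, sub_sub_cancel_left]
    ring
  simp_rw [h3]
  rw [intervalIntegral.integral_add (h1.const_mul _) (h2.const_mul _),
    intervalIntegral.integral_const_mul, intervalIntegral.integral_const_mul,
    integral_rpow_mul_fracKernel hα0 hα0 hβ hx, integral_rpow_mul_fracKernel hα0 hα0 one_pos hx,
    sub_add_cancel, inv_mul_cancel_left₀ (Real.Gamma_pos_of_pos hβ).ne', fracKernel_succ hα0
    one_pos hx]
  simp

/-! ### Positivity of the kernel -/

theorem fracKernel_volterra {α c x : ℝ} (hα : 0 < α) (hx : 0 < x) :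
    fracKernel α α c x = (Real.Gamma α)⁻¹ * (x ^ (α - 1) +
      c * ∫ y in 0..x, (x - y) ^ (α - 1) * fracKernel α α c y) := by
  have := (Real.Gamma_pos_of_pos hα).ne'
  rw [integral_rpow_mul_fracKernel hα hα hα hx, fracKernel_succ hα hα hx]
  field_simp

theorem eventually_fracKernel_pos {α c : ℝ} (hα : 0 < α) :
    ∀ᶠ x in 𝓝[>] 0, 0 < fracKernel α α c x := by
  have hc : ContinuousAt (fun x : ℝ => mittagLeffler α α (c * x ^ α)) 0 :=
    ((continuous_mittagLeffler hα hα).comp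
      (continuous_const.mul (Real.continuous_rpow_const hα.le))).continuousAt
  have h0 : 0 < mittagLeffler α α (c * (0 : ℝ) ^ α) := by
    rw [Real.zero_rpow hα.ne', mul_zero, mittagLeffler_zero]
    exact inv_pos.2 (Real.Gamma_pos_of_pos hα)
  filter_upwards [(hc.eventually_const_lt h0).filter_mono nhdsWithin_le_nhds,
    self_mem_nhdsWithin] with x hx hx0
  exact mul_pos (Real.rpow_pos_of_pos hx0 _) hx

/-- A strictly positive kernel cannot vanish for the first time at `t`: here `fracKernel` is the
resolvent of the log-convex kernel `x ^ (α - 1)`. -/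
theorem fracKernel_ne_zero_of_pos_before {α c t : ℝ} (hα0 : 0 < α) (hα1 : α < 1) (hc : c < 0)
    (ht : 0 < t) (hpos : ∀ x, 0 < x → x < t → 0 < fracKernel α α c x) :
    fracKernel α α c t ≠ 0 := by
  intro hzero
  set r := fracKernel α α c with hr
  have hΓ := Real.Gamma_pos_of_pos hα0
  have hInt : ∀ {x : ℝ}, 0 < x →
      IntervalIntegrable (fun y => (x - y) ^ (α - 1) * r y) volume 0 x :=
    fun hx => intervalIntegrable_rpow_mul_fracKernel hα0 hα0 hα0 hx
  have hcont : ContinuousOn r (Ioi 0) := continuousOn_fracKernel hα0 hα0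
  -- Compare the Volterra equations at the zero `t` and at a maximum point `x` of `r` on `[t₁, t]`.
  -- On `[0, x]` the two kernels are compared, on `[x, t]` `r` is bounded by `r x`, and finally `r x
  -- > 0` is divided out.
  have key : ∀ t₁, 0 < t₁ → t₁ < t →
      ∃ x ∈ Ico t₁ t, (t / x) ^ (α - 1) ≤ -c * (Real.Gamma α)⁻¹ * ((t - x) ^ α / α) := by
    intro t₁ ht₁ ht₁t
    obtain ⟨x, hx, hmax⟩ := isCompact_Icc.exists_isMaxOn (nonempty_Icc.2 ht₁t.le)
      (hcont.mono fun y hy => ht₁.trans_le hy.1)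
    have hx0 : 0 < x := ht₁.trans_le hx.1
    have hrt₁ : 0 < r t₁ := hpos t₁ ht₁ ht₁t
    have hrx : 0 < r x := hrt₁.trans_le (hmax (left_mem_Icc.2 ht₁t.le))
    have hxt : x < t := lt_of_le_of_ne hx.2 fun h => by
      rw [h, hzero] at hrx
      exact hrx.false
    refine ⟨x, ⟨hx.1, hxt⟩, ?_⟩
    have e1 := fracKernel_volterra (c := c) hα0 hx0
    have e2 := fracKernel_volterra (c := c) hα0 ht
    rw [← hr] at e1 e2
    rw [hzero] at e2
    have e2' : t ^ (α - 1) = -c * ∫ y in 0..t, (t - y) ^ (α - 1) * r y := by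
      have := (mul_eq_zero.1 e2.symm).resolve_left (inv_ne_zero hΓ.ne')
      linarith
    have e1' : -c * ∫ y in 0..x, (x - y) ^ (α - 1) * r y = x ^ (α - 1) - Real.Gamma α * r x := by
      rw [e1]
      field_simp
      ring
    have hsub1 : IntervalIntegrable (fun y => (t - y) ^ (α - 1) * r y) volume 0 x :=
      (hInt ht).mono_set (by rw [uIcc_of_le hx0.le, uIcc_of_le ht.le]; exact Icc_subset_Icc_right hxt.le)
    have hsub2 : IntervalIntegrable (fun y => (t - y) ^ (α - 1) * r y) volume x t :=
      (hInt ht).mono_set (by rw [uIcc_of_le hxt.le, uIcc_of_le ht.le]; exact Icc_subset_Icc_left hx0.le)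
    -- Since `(t / x) * (x - y) = t - t * y / x ≤ t - y` and the exponent `α - 1` is negative.
    have hI1 : ∫ y in 0..x, (t - y) ^ (α - 1) * r y ≤
        (t / x) ^ (α - 1) * ∫ y in 0..x, (x - y) ^ (α - 1) * r y := by
      rw [← intervalIntegral.integral_const_mul]
      refine intervalIntegral.integral_mono_on_of_le_Ioo hx0.le hsub1
        ((hInt hx0).const_mul _) fun y hy => ?_
      have hxy : 0 < x - y := sub_pos.2 hy.2
      have hry := hpos y hy.1 (hy.2.trans hxt)
      rw [← mul_assoc, ← Real.mul_rpow (by positivity) hxy.le]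
      refine mul_le_mul_of_nonneg_right (Real.rpow_le_rpow_of_nonpos (by positivity) ?_
        (by linarith)) hry.le
      rw [div_mul_eq_mul_div, div_le_iff₀ hx0]
      nlinarith [hy.1]
    have hpow : IntervalIntegrable (fun y => (t - y) ^ (α - 1)) volume x t :=
      intervalIntegrable_sub_rpow (by linarith)
    have hpowI : ∫ y in x..t, (t - y) ^ (α - 1) = (t - x) ^ α / α := by
      rw [intervalIntegral.integral_comp_sub_left (fun y => y ^ (α - 1)) t, sub_self,
        integral_rpow (Or.inl (by linarith)), sub_add_cancel, Real.zero_rpow hα0.ne', sub_zero]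
    have hI2 : ∫ y in x..t, (t - y) ^ (α - 1) * r y ≤ r x * ((t - x) ^ α / α) := by
      rw [← hpowI, ← intervalIntegral.integral_const_mul]
      refine intervalIntegral.integral_mono_on hxt.le hsub2 (hpow.const_mul _) fun y hy => ?_
      rw [mul_comm]
      exact mul_le_mul_of_nonneg_right (hmax ⟨hx.1.trans hy.1, hy.2⟩)
        (Real.rpow_nonneg (sub_nonneg.2 hy.2) _)
    rw [← intervalIntegral.integral_add_adjacent_intervals hsub1 hsub2] at e2'
    have hq : (t / x) ^ (α - 1) * x ^ (α - 1) = t ^ (α - 1) := by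
      rw [← Real.mul_rpow (by positivity) hx0.le, div_mul_cancel₀ _ hx0.ne']
    have h1 := mul_le_mul_of_nonneg_left (add_le_add hI1 hI2) (neg_nonneg.2 hc.le)
    have h2 : -c * ((t / x) ^ (α - 1) * ∫ y in 0..x, (x - y) ^ (α - 1) * r y) =
        t ^ (α - 1) - (t / x) ^ (α - 1) * (Real.Gamma α * r x) := by
      rw [mul_left_comm, e1', mul_sub, hq]
    rw [← e2', mul_add, h2] at h1
    have h3 : r x * (Real.Gamma α * (t / x) ^ (α - 1)) ≤ r x * (-c * ((t - x) ^ α / α)) := by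
      linarith
    have h4 := le_of_mul_le_mul_left h3 hrx
    have h5 := mul_le_mul_of_nonneg_left h4 (inv_pos.2 hΓ).le
    rw [inv_mul_cancel_left₀ hΓ.ne'] at h5
    linarith
  -- As `x → t` the two sides of `key` tend to `1` and `0`, so `key` fails for `t₁` close to `t`.
  have hlim : Tendsto (fun x : ℝ => (t / x) ^ (α - 1) -
      -c * (Real.Gamma α)⁻¹ * ((t - x) ^ α / α)) (𝓝[<] t) (𝓝 1) := by
    have h1 : ContinuousAt (fun x : ℝ => (t / x) ^ (α - 1) -
        -c * (Real.Gamma α)⁻¹ * ((t - x) ^ α / α)) t := by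
      refine ContinuousAt.sub ?_ (ContinuousAt.mul continuousAt_const (ContinuousAt.div_const ?_ _))
      · exact (continuousAt_const.div continuousAt_id ht.ne').rpow_const
          (Or.inl (by simp [ht.ne']))
      · exact (continuousAt_const.sub continuousAt_id).rpow_const (Or.inr hα0.le)
    have h2 := h1.tendsto.mono_left (nhdsWithin_le_nhds (s := Iio t))
    simpa [div_self ht.ne', Real.zero_rpow hα0.ne'] using h2
  obtain ⟨s, hs, hsub⟩ := mem_nhdsLT_iff_exists_Ioo_subset.1
    (hlim.eventually_const_lt one_pos)
  have hs' : max s 0 < t := max_lt hs ht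
  obtain ⟨t₁, ht₁, ht₁t⟩ := exists_between hs'
  obtain ⟨x, hx, hle⟩ := key t₁ ((le_max_right _ _).trans_lt ht₁) ht₁t
  have := hsub ⟨((le_max_left _ _).trans_lt ht₁).trans_le hx.1, hx.2⟩
  simp only [mem_ofPred_eq] at this
  linarith

/-- The kernel of the operator `(D_t^α + μ)⁻¹` is positive. -/
theorem fracKernel_pos {α c x : ℝ} (hα0 : 0 < α) (hα1 : α < 1) (hx : 0 < x) :
    0 < fracKernel α α c x := by
  rcases le_or_gt 0 c with hc | hc
  -- For `c ≥ 0` every term of the series is non-negative and the first one is positive.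
  · have hΓ := Real.Gamma_pos_of_pos hα0
    refine mul_pos (Real.rpow_pos_of_pos hx _) ?_
    refine (summable_mittagLeffler hα0 hα0 _).tsum_pos (fun k => ?_) 0 ?_
    · have := Real.Gamma_pos_of_pos (show 0 < α * k + α by positivity)
      positivity
    · simpa using hΓ
  by_contra! hneg
  obtain ⟨δ, hδ, hδpos⟩ := mem_nhdsGT_iff_exists_Ioo_subset.1
    (eventually_fracKernel_pos (c := c) hα0)
  have hδ0 : 0 < δ := hδ
  have hcont : ContinuousOn (fracKernel α α c) (Ioi 0) := continuousOn_fracKernel hα0 hα0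
  have hδx : δ ≤ x := by
    by_contra! h
    exact absurd (hδpos ⟨hx, h⟩) (not_lt.2 hneg)
  -- The kernel is positive on `(0, δ)`, so the least point of this compact set is the first time at
  -- which positivity fails; by continuity the kernel vanishes there.
  let S : Set ℝ := Icc (δ / 2) x ∩ fracKernel α α c ⁻¹' Iic 0
  have hS : IsCompact S := by
    refine isCompact_Icc.of_isClosed_subset ?_ inter_subset_left
    exact (hcont.mono fun y hy => (half_pos hδ0).trans_le hy.1).preimage_isClosed_of_isClosed
      isClosed_Icc isClosed_Iic
  obtain ⟨t, htS, htmin⟩ := hS.exists_isLeast ⟨x, ⟨by linarith, le_rfl⟩, hneg⟩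
  have ht0 : 0 < t := (half_pos hδ0).trans_le htS.1.1
  have hbefore : ∀ y, 0 < y → y < t → 0 < fracKernel α α c y := by
    intro y hy hyt
    rcases lt_or_ge y δ with h | h
    · exact hδpos ⟨hy, h⟩
    · by_contra! hle
      exact absurd (htmin ⟨⟨by linarith, hyt.le.trans htS.1.2⟩, hle⟩) (not_le.2 hyt)
  refine fracKernel_ne_zero_of_pos_before hα0 hα1 hc ht0 hbefore (le_antisymm htS.2 ?_)
  have hct := (hcont.continuousAt (Ioi_mem_nhds ht0)).tendsto.mono_left
    (nhdsWithin_le_nhds (s := Iio t))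
  refine ge_of_tendsto hct ?_
  filter_upwards [Ioo_mem_nhdsLT ht0] with y hy
  exact (hbefore y hy.1 hy.2).le

/-! ### Inversion of the fractional operator on absolutely continuous functions -/

theorem measurable_fracKernel {α β c : ℝ} (hα : 0 < α) (hβ : 0 < β) :
    Measurable (fracKernel α β c) := by
  have := (continuous_mittagLeffler hα hβ).measurable
  unfold fracKernel
  fun_prop

theorem measurable_resolventSymbol {α μ : ℝ} : Measurable (resolventSymbol α μ) := by
  unfold resolventSymbol
  fun_prop

theorem intervalIntegrable_fracKernel {α c x : ℝ} (hα : 0 < α) (hx : 0 < x) :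
    IntervalIntegrable (fracKernel α α c) volume 0 x := by
  simpa using intervalIntegrable_rpow_mul_fracKernel (c := c) hα hα one_pos hx

theorem intervalIntegrable_fracKernel_sub {α c r t : ℝ} (hα : 0 < α) (hrt : r < t) :
    IntervalIntegrable (fun s => fracKernel α α c (t - s)) volume r t := by
  simpa using ((intervalIntegrable_fracKernel (c := c) hα (sub_pos.2 hrt)).comp_sub_left t).symm

theorem intervalIntegrable_fracKernel_mul_resolventSymbol {α μ r t : ℝ} (hα0 : 0 < α)
    (hα1 : α < 1) (hrt : r < t) : IntervalIntegrable
      (fun s => fracKernel α α (-μ) (t - s) * resolventSymbol α μ (s - r)) volume r t := by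
  have h := ((intervalIntegrable_resolventSymbol_mul_fracKernel (μ := μ) hα0 hα1
    (sub_pos.2 hrt)).comp_sub_left t).symm
  simp only [sub_zero, sub_sub_cancel] at h
  refine h.congr fun s _ => ?_
  rw [mul_comm, show t - r - (t - s) = s - r by ring]

theorem integral_fracKernel_mul_resolventSymbol {α μ r t : ℝ} (hα0 : 0 < α) (hα1 : α < 1)
    (hrt : r < t) :
    ∫ s in r..t, fracKernel α α (-μ) (t - s) * resolventSymbol α μ (s - r) = 1 := by
  rw [← integral_resolventSymbol_mul_fracKernel (μ := μ) hα0 hα1 (sub_pos.2 hrt)]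
  have h := intervalIntegral.integral_comp_sub_left (a := r) (b := t)
    (fun y => resolventSymbol α μ (t - r - y) * fracKernel α α (-μ) y) t
  rw [sub_self] at h
  rw [← h]
  refine intervalIntegral.integral_congr fun s _ => ?_
  rw [mul_comm, show t - r - (t - s) = s - r by ring]

/-- For `μ < 0` the symbol may change sign, but `|h| ≤ h + 2|μ|` and the kernel is positive. The
bound does not depend on `r`, which gives the absolute integrability needed for Fubini. -/
theorem integral_fracKernel_mul_abs_resolventSymbol_le {α μ a r t : ℝ} (hα0 : 0 < α)
    (hα1 : α < 1) (har : a ≤ r) (hrt : r < t) :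
    ∫ s in r..t, |fracKernel α α (-μ) (t - s) * resolventSymbol α μ (s - r)| ≤
      1 + 2 * |μ| * ∫ s in a..t, fracKernel α α (-μ) (t - s) := by
  have hk := intervalIntegrable_fracKernel_sub (c := -μ) hα0 (har.trans_lt hrt)
  have hkr := intervalIntegrable_fracKernel_sub (c := -μ) hα0 hrt
  have hkh := intervalIntegrable_fracKernel_mul_resolventSymbol (μ := μ) hα0 hα1 hrt
  have hΓ := Real.Gamma_pos_of_pos (sub_pos.2 hα1)
  calc ∫ s in r..t, |fracKernel α α (-μ) (t - s) * resolventSymbol α μ (s - r)|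
      ≤ ∫ s in r..t, (fracKernel α α (-μ) (t - s) * resolventSymbol α μ (s - r) +
          2 * |μ| * fracKernel α α (-μ) (t - s)) := by
        refine intervalIntegral.integral_mono_on_of_le_Ioo hrt.le hkh.abs
          (hkh.add (hkr.const_mul _)) fun s hs => ?_
        have h1 := fracKernel_pos (c := -μ) hα0 hα1 (sub_pos.2 hs.2)
        have h2 : |resolventSymbol α μ (s - r)| ≤ resolventSymbol α μ (s - r) + 2 * |μ| := by
          have h3 : 0 ≤ (Real.Gamma (1 - α))⁻¹ * (s - r) ^ (-α) :=
            mul_nonneg (inv_pos.2 hΓ).le (Real.rpow_nonneg (sub_nonneg.2 hs.1.le) _)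
          rw [resolventSymbol, abs_le]
          constructor <;> linarith [neg_abs_le μ, abs_nonneg μ]
        rw [abs_mul, abs_of_pos h1]
        nlinarith
    _ = 1 + 2 * |μ| * ∫ s in r..t, fracKernel α α (-μ) (t - s) := by
        rw [intervalIntegral.integral_add hkh (hkr.const_mul _),
          integral_fracKernel_mul_resolventSymbol hα0 hα1 hrt, intervalIntegral.integral_const_mul]
    _ ≤ _ := by
        have : ∫ s in r..t, fracKernel α α (-μ) (t - s) ≤
            ∫ s in a..t, fracKernel α α (-μ) (t - s) := by
          refine intervalIntegral.integral_mono_interval har hrt.le le_rfl ?_ hk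
          rw [← restrict_Ioo_eq_restrict_Ioc]
          filter_upwards [ae_restrict_mem measurableSet_Ioo] with s hs
          exact (fracKernel_pos hα0 hα1 (sub_pos.2 hs.2)).le
        gcongr

/-- Fubini's theorem for the composition of `fracKernel` and `resolventSymbol`. -/
theorem integral_fracKernel_mul_integral_resolventSymbol {α μ a t : ℝ} {g : ℝ → ℝ} (hα0 : 0 < α)
    (hα1 : α < 1) (hat : a < t) (hg : IntervalIntegrable g volume a t) :
    IntervalIntegrable (fun s => fracKernel α α (-μ) (t - s) *
      ∫ r in a..s, resolventSymbol α μ (s - r) * g r) volume a t ∧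
    ∫ s in a..t, fracKernel α α (-μ) (t - s) *
      ∫ r in a..s, resolventSymbol α μ (s - r) * g r = ∫ r in a..t, g r := by
  set ν : Measure ℝ := volume.restrict (Ioc a t) with hν
  -- The indicator of the triangle `r ≤ s` puts both iterated integrals on the square `(a, t]²`.
  let K : ℝ × ℝ → ℝ := {p : ℝ × ℝ | p.2 ≤ p.1}.indicator
    fun p => fracKernel α α (-μ) (t - p.1) * resolventSymbol α μ (p.1 - p.2)
  have hKm : Measurable K := by
    refine Measurable.indicator ?_ (measurableSet_le measurable_snd measurable_fst)
    exact ((measurable_fracKernel hα0 hα0).comp (measurable_const.sub measurable_fst)).mul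
      (measurable_resolventSymbol.comp (measurable_fst.sub measurable_snd))
  have hg1 : Integrable g ν := hg.1
  have hKsec : ∀ r, (fun s => K (s, r)) = (Ici r).indicator
      fun s => fracKernel α α (-μ) (t - s) * resolventSymbol α μ (s - r) := by
    intro r
    ext s
    simp only [K, indicator, mem_ofPred_eq, mem_Ici]
  have hset : ∀ r ∈ Ioo a t, Ioc a t ∩ Ici r = Icc r t := by
    intro r hr
    ext s
    simp only [mem_inter_iff, mem_Ioc, mem_Ici, mem_Icc]
    constructor
    · exact fun h => ⟨h.2, h.1.2⟩
    · exact fun h => ⟨⟨hr.1.trans_le h.1, h.2⟩, h.1⟩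
  have hKint : ∀ r ∈ Ioo a t, Integrable (fun s => K (s, r)) ν := by
    intro r hr
    rw [hKsec, integrable_indicator_iff measurableSet_Ici, IntegrableOn, hν,
      Measure.restrict_restrict measurableSet_Ici, inter_comm, hset r hr, ← IntegrableOn,
      integrableOn_Icc_iff_integrableOn_Ioc]
    exact (intervalIntegrable_fracKernel_mul_resolventSymbol hα0 hα1 hr.2).1
  have hKval : ∀ r ∈ Ioo a t, ∫ s, K (s, r) ∂ν = 1 := by
    intro r hr
    rw [hKsec, integral_indicator measurableSet_Ici, hν,
      Measure.restrict_restrict measurableSet_Ici, inter_comm, hset r hr,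
      integral_Icc_eq_integral_Ioc, ← intervalIntegral.integral_of_le hr.2.le,
      integral_fracKernel_mul_resolventSymbol hα0 hα1 hr.2]
  have hKabs : ∀ r ∈ Ioo a t, ∫ s, ‖K (s, r)‖ ∂ν ≤
      1 + 2 * |μ| * ∫ s in a..t, fracKernel α α (-μ) (t - s) := by
    intro r hr
    have h : (fun s => ‖K (s, r)‖) = (Ici r).indicator
        fun s => |fracKernel α α (-μ) (t - s) * resolventSymbol α μ (s - r)| := by
      ext s
      rw [congrFun (hKsec r) s, norm_indicator_eq_indicator_norm]
      rfl
    rw [h, integral_indicator measurableSet_Ici, hν,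
      Measure.restrict_restrict measurableSet_Ici, inter_comm, hset r hr,
      integral_Icc_eq_integral_Ioc, ← intervalIntegral.integral_of_le hr.2.le]
    exact integral_fracKernel_mul_abs_resolventSymbol_le hα0 hα1 hr.1.le hr.2
  have hae : ∀ᵐ r ∂ν, r ∈ Ioo a t := by
    rw [hν, ← restrict_Ioo_eq_restrict_Ioc]
    exact ae_restrict_mem measurableSet_Ioo
  have hF : Integrable (fun p : ℝ × ℝ => K p * g p.2) (ν.prod ν) := by
    have hFm : AEStronglyMeasurable (fun p : ℝ × ℝ => K p * g p.2) (ν.prod ν) :=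
      hKm.aestronglyMeasurable.mul hg1.aestronglyMeasurable.comp_snd
    rw [integrable_prod_iff' hFm]
    refine ⟨?_, ?_⟩
    · filter_upwards [hae] with r hr
      exact (hKint r hr).mul_const _
    · refine (hg1.norm.const_mul (1 + 2 * |μ| * ∫ s in a..t, fracKernel α α (-μ) (t - s))).mono'
        ?_ ?_
      · exact hFm.norm.prod_swap.integral_prod_right'
      · filter_upwards [hae] with r hr
        have : 0 ≤ ∫ s, ‖K (s, r) * g r‖ ∂ν := integral_nonneg fun _ => norm_nonneg _
        rw [Real.norm_eq_abs, abs_of_nonneg this]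
        simp_rw [norm_mul]
        rw [integral_mul_const]
        exact mul_le_mul_of_nonneg_right (hKabs r hr) (norm_nonneg _)
  have hinner : ∀ s ∈ Ioc a t, ∫ r, K (s, r) * g r ∂ν =
      fracKernel α α (-μ) (t - s) * ∫ r in a..s, resolventSymbol α μ (s - r) * g r := by
    intro s hs
    have h : (fun r => K (s, r) * g r) = (Iic s).indicator
        fun r => fracKernel α α (-μ) (t - s) * (resolventSymbol α μ (s - r) * g r) := by
      ext r
      simp only [K, indicator, mem_ofPred_eq, mem_Iic]
      split_ifs <;> ring
    rw [h, integral_indicator measurableSet_Iic, hν,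
      Measure.restrict_restrict measurableSet_Iic, inter_comm, Ioc_inter_Iic,
      min_eq_right hs.2, ← intervalIntegral.integral_of_le hs.1.le,
      intervalIntegral.integral_const_mul]
  constructor
  · rw [intervalIntegrable_iff_integrableOn_Ioc_of_le hat.le]
    exact IntegrableOn.congr_fun (f := fun s => ∫ r, K (s, r) * g r ∂ν) hF.integral_prod_left
      hinner measurableSet_Ioc
  · rw [intervalIntegral.integral_of_le hat.le, intervalIntegral.integral_of_le hat.le,
      ← setIntegral_congr_fun measurableSet_Ioc hinner]
    rw [integral_integral_swap hF]
    refine integral_congr_ae ?_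
    filter_upwards [hae] with r hr
    rw [integral_mul_const, hKval r hr, one_mul]

/-- `Γ(1-α)⁻¹ ((s-a)^{-α} v(a) + ∫_a^s (s-r)^{-α} g(r) dr) + μ v(s)` for `v' = g` on `[a, s]`:
the operator `D_t^α + μ` applied to `v` truncated to `[a, ∞)`. -/
noncomputable def truncatedOp (α μ : ℝ) (v g : ℝ → ℝ) (a s : ℝ) : ℝ :=
  resolventSymbol α μ (s - a) * v a + ∫ r in a..s, resolventSymbol α μ (s - r) * g r

theorem intervalIntegrable_fracKernel_mul_truncatedOp {α μ a t : ℝ} {v g : ℝ → ℝ} (hα0 : 0 < α)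
    (hα1 : α < 1) (hat : a < t) (hv : HasTimeDeriv v g a t) : IntervalIntegrable
      (fun s => fracKernel α α (-μ) (t - s) * truncatedOp α μ v g a s) volume a t := by
  refine (((intervalIntegrable_fracKernel_mul_resolventSymbol (μ := μ) hα0 hα1 hat).mul_const
    (v a)).add (integral_fracKernel_mul_integral_resolventSymbol (μ := μ) hα0 hα1 hat
      hv.1).1).congr fun s _ => ?_
  simp only [truncatedOp]
  ring

/-- Both `v a` and each `g r` get the total weight `1`, whence `v a + ∫ g = v t`. This is the exact
inversion on which every comparison rests. -/
theorem integral_fracKernel_mul_truncatedOp {α μ a t : ℝ} {v g : ℝ → ℝ} (hα0 : 0 < α)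
    (hα1 : α < 1) (hat : a < t) (hv : HasTimeDeriv v g a t) :
    ∫ s in a..t, fracKernel α α (-μ) (t - s) * truncatedOp α μ v g a s = v t := by
  have h := integral_fracKernel_mul_integral_resolventSymbol (μ := μ) hα0 hα1 hat hv.1
  have e : ∀ s, fracKernel α α (-μ) (t - s) * truncatedOp α μ v g a s =
      fracKernel α α (-μ) (t - s) * resolventSymbol α μ (s - a) * v a +
        fracKernel α α (-μ) (t - s) * ∫ r in a..s, resolventSymbol α μ (s - r) * g r := by
    intro s
    rw [truncatedOp]
    ring
  simp_rw [e]
  rw [intervalIntegral.integral_add ((intervalIntegrable_fracKernel_mul_resolventSymbol hα0 hα1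
    hat).mul_const _) h.1, intervalIntegral.integral_mul_const, h.2,
    integral_fracKernel_mul_resolventSymbol hα0 hα1 hat, one_mul, hv.2 t ⟨hat.le, le_rfl⟩]

theorem intervalIntegrable_fracKernel_mul_resolventSymbol_sub {α μ a t : ℝ} (hα0 : 0 < α)
    (hα1 : α < 1) (ha : 0 < a) (hat : a < t) : IntervalIntegrable (fun s =>
      fracKernel α α (-μ) (t - s) * (resolventSymbol α μ (s - a) - resolventSymbol α μ s))
      volume a t := by
  have h := intervalIntegrable_fracKernel_mul_resolventSymbol (μ := μ) hα0 hα1 (ha.trans hat)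
  simp only [sub_zero] at h
  simp_rw [mul_sub]
  refine (intervalIntegrable_fracKernel_mul_resolventSymbol hα0 hα1 hat).sub (h.mono_set ?_)
  rw [uIcc_of_le hat.le, uIcc_of_le (ha.trans hat).le]
  exact Icc_subset_Icc_left ha.le

/-- The error caused by truncating the time interval vanishes in the limit. -/
theorem tendsto_integral_fracKernel_mul_resolventSymbol_sub {α μ t : ℝ} (hα0 : 0 < α)
    (hα1 : α < 1) (ht : 0 < t) : Tendsto (fun a => ∫ s in a..t,
      fracKernel α α (-μ) (t - s) * (resolventSymbol α μ (s - a) - resolventSymbol α μ s))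
      (𝓝[>] 0) (𝓝 0) := by
  have h := intervalIntegrable_fracKernel_mul_resolventSymbol (μ := μ) hα0 hα1 ht
  have h1 := integral_fracKernel_mul_resolventSymbol (μ := μ) hα0 hα1 ht
  simp only [sub_zero] at h h1
  have hc := intervalIntegral.continuousOn_primitive_interval' h left_mem_uIcc
  rw [uIcc_of_le ht.le] at hc
  -- The kernel against the shifted symbol on `[a, t]` and against the unshifted symbol on `[0, t]`
  -- both integrate to `1`, so the difference in question is exactly this integral over `[0, a]`.
  have hlim : Tendsto (fun a => ∫ s in (0 : ℝ)..a,
      fracKernel α α (-μ) (t - s) * resolventSymbol α μ s) (𝓝[>] 0) (𝓝 0) := by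
    have := (hc 0 ⟨le_rfl, ht.le⟩).tendsto
    rw [intervalIntegral.integral_same] at this
    refine this.mono_left ?_
    rw [← nhdsWithin_Ioo_eq_nhdsGT ht]
    exact nhdsWithin_mono _ Ioo_subset_Icc_self
  refine hlim.congr' ?_
  filter_upwards [Ioo_mem_nhdsGT ht] with a ha
  have hsub1 : IntervalIntegrable (fun s => fracKernel α α (-μ) (t - s) * resolventSymbol α μ s)
      volume 0 a := h.mono_set (by
    rw [uIcc_of_le ha.1.le, uIcc_of_le ht.le]
    exact Icc_subset_Icc_right ha.2.le)
  have hsub2 : IntervalIntegrable (fun s => fracKernel α α (-μ) (t - s) * resolventSymbol α μ s)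
      volume a t := h.mono_set (by
    rw [uIcc_of_le ha.2.le, uIcc_of_le ht.le]
    exact Icc_subset_Icc_left ha.1.le)
  rw [← intervalIntegral.integral_add_adjacent_intervals hsub1 hsub2] at h1
  simp_rw [mul_sub]
  rw [intervalIntegral.integral_sub
    (intervalIntegrable_fracKernel_mul_resolventSymbol hα0 hα1 ha.2) hsub2,
    integral_fracKernel_mul_resolventSymbol hα0 hα1 ha.2]
  linarith

/-! ### Integration by parts and truncation of the Caputo derivative -/

section Regularity

variable {X : Type*} [NormedAddCommGroup X] [NormedSpace ℝ X]

theorem HasTimeDeriv.mono {v g : ℝ → X} {a b c d : ℝ} (hv : HasTimeDeriv v g a b) (hac : a ≤ c)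
    (hcd : c ≤ d) (hdb : d ≤ b) : HasTimeDeriv v g c d := by
  have hsub : ∀ {x y}, a ≤ x → x ≤ y → y ≤ b → IntervalIntegrable g volume x y :=
    fun hax hxy hyb => hv.1.mono_set (by
      rw [uIcc_of_le hxy, uIcc_of_le (hax.trans (hxy.trans hyb))]
      exact Icc_subset_Icc hax hyb)
  refine ⟨hsub hac hcd hdb, fun s hs => ?_⟩
  rw [hv.2 s ⟨hac.trans hs.1, hs.2.trans hdb⟩, hv.2 c ⟨hac, hcd.trans hdb⟩, add_assoc,
    intervalIntegral.integral_add_adjacent_intervals (hsub le_rfl hac (hcd.trans hdb))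
      (hsub hac hs.1 (hs.2.trans hdb))]

theorem HasTimeDeriv.continuousOn {v g : ℝ → X} {a b : ℝ} (hv : HasTimeDeriv v g a b)
    (hab : a ≤ b) : ContinuousOn v (Icc a b) := by
  have h := intervalIntegral.continuousOn_primitive_interval' hv.1 left_mem_uIcc
  rw [uIcc_of_le hab] at h
  exact (continuousOn_const.add h).congr hv.2

theorem HasTimeDeriv.sub {v w g h : ℝ → X} {a b : ℝ} (hv : HasTimeDeriv v g a b)
    (hw : HasTimeDeriv w h a b) (hab : a ≤ b) :
    HasTimeDeriv (fun s => v s - w s) (fun s => g s - h s) a b := by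
  refine ⟨hv.1.sub hw.1, fun s hs => ?_⟩
  have hsub : uIcc a s ⊆ uIcc a b := by
    rw [uIcc_of_le hs.1, uIcc_of_le hab]
    exact Icc_subset_Icc_right hs.2
  beta_reduce
  rw [hv.2 s hs, hw.2 s hs,
    intervalIntegral.integral_sub (hv.1.mono_set hsub) (hw.1.mono_set hsub)]
  abel

theorem HasTimeDeriv.clm_comp [CompleteSpace X] {v g : ℝ → X} {a b : ℝ}
    (hv : HasTimeDeriv v g a b) (L : X →L[ℝ] ℝ) (hab : a ≤ b) :
    HasTimeDeriv (fun s => L (v s)) (fun s => L (g s)) a b := by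
  refine ⟨⟨L.integrable_comp hv.1.1, L.integrable_comp hv.1.2⟩, fun s hs => ?_⟩
  have hsub : uIcc a s ⊆ uIcc a b := by
    rw [uIcc_of_le hs.1, uIcc_of_le hab]
    exact Icc_subset_Icc_right hs.2
  beta_reduce
  rw [hv.2 s hs, map_add, L.intervalIntegral_comp_comm (hv.1.mono_set hsub)]

theorem HasTimeDeriv.ae_hasDerivAt [CompleteSpace X] {v g : ℝ → X} {a b : ℝ}
    (hv : HasTimeDeriv v g a b) (hab : a ≤ b) :
    ∀ᵐ r, r ∈ Ioo a b → HasDerivAt v (g r) r := by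
  filter_upwards [hv.1.ae_hasDerivAt_integral] with r hr hrab
  have hmem : r ∈ uIcc a b := by
    rw [uIcc_of_le hab]
    exact Ioo_subset_Icc_self hrab
  refine ((hr hmem a left_mem_uIcc).const_add (v a)).congr_of_eventuallyEq ?_
  filter_upwards [Ioo_mem_nhds hrab.1 hrab.2] with x hx
  exact hv.2 x (Ioo_subset_Icc_self hx)

theorem HasTimeDeriv.congr_deriv {v g h : ℝ → X} {a b : ℝ} (hv : HasTimeDeriv v g a b)
    (hab : a ≤ b) (hgh : ∀ᵐ r, r ∈ Ioo a b → g r = h r) : HasTimeDeriv v h a b := by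
  have hgh' : ∀ s ∈ Icc a b, ∀ᵐ r, r ∈ uIoc a s → g r = h r := by
    intro s hs
    filter_upwards [hgh, show ∀ᵐ r, r ≠ s by simp [ae_iff, measure_singleton]] with r hr hrs hr'
    rw [uIoc_of_le hs.1] at hr'
    exact hr ⟨hr'.1, (lt_of_le_of_ne hr'.2 hrs).trans_le hs.2⟩
  refine ⟨hv.1.congr_ae ?_, fun s hs => ?_⟩
  · rw [EventuallyEq, ae_restrict_iff' measurableSet_uIoc]
    exact hgh' b ⟨hab, le_rfl⟩
  · rw [hv.2 s hs, intervalIntegral.integral_congr_ae (hgh' s hs)]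

end Regularity

/-- Applied to the norm of a vector-valued function, this avoids a chain rule for the norm. -/
theorem _root_.LipschitzOnWith.hasTimeDeriv_deriv {v : ℝ → ℝ} {C : NNReal} {a b : ℝ}
    (hv : LipschitzOnWith C v (Icc a b)) (hab : a ≤ b) : HasTimeDeriv v (deriv v) a b := by
  have hac : ∀ s ∈ Icc a b, AbsolutelyContinuousOnInterval v a s := fun s hs =>
    LipschitzOnWith.absolutelyContinuousOnInterval (K := C) (by
      rw [uIcc_of_le hs.1]
      exact hv.mono (Icc_subset_Icc_right hs.2))
  refine ⟨(hac b ⟨hab, le_rfl⟩).intervalIntegrable_deriv, fun s hs => ?_⟩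
  rw [(hac s hs).integral_deriv_eq_sub]
  ring

theorem continuousOn_sub_rpow {s b p : ℝ} (hbs : b < s) :
    ContinuousOn (fun r : ℝ => (s - r) ^ p) (Iic b) := by
  intro r hr
  have : (s - r) ≠ 0 := by
    have : r ≤ b := hr
    linarith
  exact ((continuousAt_const.sub continuousAt_id).rpow_const (Or.inl this)).continuousWithinAt

theorem HasTimeDeriv.integral_rpow_mul {v g : ℝ → ℝ} {a b s α : ℝ} (hv : HasTimeDeriv v g a b)
    (hab : a ≤ b) (hbs : b < s) :
    ∫ r in a..b, (s - r) ^ (-α) * g r =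
      (s - b) ^ (-α) * v b - (s - a) ^ (-α) * v a -
        ∫ r in a..b, α * (s - r) ^ (-α - 1) * v r := by
  -- `V` agrees with `v` on `[a, b]` and is absolutely continuous as a primitive; `b < s` keeps the
  -- weight smooth.
  set V : ℝ → ℝ := fun r => v a + ∫ x in a..r, g x with hV
  have hVac : AbsolutelyContinuousOnInterval V a b :=
    (LipschitzOnWith.absolutelyContinuousOnInterval (K := 0)
      (LipschitzWith.const (v a)).lipschitzOnWith).add
      (hv.1.absolutelyContinuousOnInterval_intervalIntegral left_mem_uIcc)
  have hwd : ∀ r ∈ Icc a b, HasDerivAt (fun r => (s - r) ^ (-α)) (α * (s - r) ^ (-α - 1)) r := by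
    intro r hr
    have h := ((hasDerivAt_id r).const_sub s).rpow_const (p := -α)
      (Or.inl (by simp only [id]; linarith [hr.2]))
    simpa using h
  have hwac : AbsolutelyContinuousOnInterval (fun r => (s - r) ^ (-α)) a b := by
    refine ContDiffOn.absolutelyContinuousOnInterval
      ((contDiffOn_const.sub contDiffOn_id).rpow_const_of_ne fun r hr => ?_)
    rw [uIcc_of_le hab] at hr
    simp only [id]
    linarith [hr.2]
  have hibp := AbsolutelyContinuousOnInterval.integral_mul_deriv_eq_deriv_mul hwac hVac
  have hVd : ∀ᵐ r, r ∈ uIoc a b → deriv V r = g r := by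
    filter_upwards [hv.1.ae_hasDerivAt_integral] with r hr hrab
    exact ((hr (uIoc_subset_uIcc hrab) a left_mem_uIcc).const_add (v a)).deriv
  have e1 : ∫ r in a..b, (s - r) ^ (-α) * deriv V r = ∫ r in a..b, (s - r) ^ (-α) * g r := by
    refine intervalIntegral.integral_congr_ae ?_
    filter_upwards [hVd] with r hr hrab
    rw [hr hrab]
  have e2 : ∫ r in a..b, deriv (fun r => (s - r) ^ (-α)) r * V r =
      ∫ r in a..b, α * (s - r) ^ (-α - 1) * v r := by
    refine intervalIntegral.integral_congr fun r hr => ?_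
    rw [uIcc_of_le hab] at hr
    rw [(hwd r hr).deriv, hv.2 r hr]
  have e3 : V b = v b := (hv.2 b ⟨hab, le_rfl⟩).symm
  have e4 : V a = v a := by simp [hV]
  rw [← e1, hibp, e2, e3, e4]

theorem integral_rpow_neg_sub_one {a b s α : ℝ} (hab : a ≤ b) (hbs : b < s) :
    ∫ r in a..b, α * (s - r) ^ (-α - 1) = (s - b) ^ (-α) - (s - a) ^ (-α) := by
  have h : HasTimeDeriv (fun _ : ℝ => (1 : ℝ)) (fun _ => 0) a b := ⟨by simp, by simp⟩
  have := h.integral_rpow_mul (α := α) hab hbs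
  simp only [mul_zero, mul_one, intervalIntegral.integral_zero] at this
  linarith

/-- `Γ(1-α)` times the Caputo derivative of `v` (with `v' = g`) truncated to `[a, ∞)`. -/
noncomputable def truncatedCaputo (α : ℝ) (v g : ℝ → ℝ) (a s : ℝ) : ℝ :=
  (s - a) ^ (-α) * v a + ∫ r in a..s, (s - r) ^ (-α) * g r

theorem truncatedOp_eq {α μ a s : ℝ} {v g : ℝ → ℝ} (has : a ≤ s) (hv : HasTimeDeriv v g a s)
    (hg : IntervalIntegrable (fun r => (s - r) ^ (-α) * g r) volume a s) :
    truncatedOp α μ v g a s = (Real.Gamma (1 - α))⁻¹ * truncatedCaputo α v g a s + μ * v s := by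
  have e : ∀ r, resolventSymbol α μ (s - r) * g r =
      (Real.Gamma (1 - α))⁻¹ * ((s - r) ^ (-α) * g r) + μ * g r := by
    intro r
    rw [resolventSymbol]
    ring
  simp_rw [truncatedOp, e]
  rw [intervalIntegral.integral_add (hg.const_mul _) (hv.1.const_mul _),
    intervalIntegral.integral_const_mul, intervalIntegral.integral_const_mul,
    hv.2 s ⟨has, le_rfl⟩, truncatedCaputo, resolventSymbol]
  ring

/-- Integration by parts on `[η, ε]` cancels the boundary terms against the two initial terms. What
remains contains `v` with a non-negative weight for `α > 0`, so bounds on `v` control the effect of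
moving the truncation point. -/
theorem truncatedCaputo_sub {α η ε s : ℝ} {v g : ℝ → ℝ} (hηε : η ≤ ε) (hεs : ε < s)
    (hv : HasTimeDeriv v g η s)
    (hg : IntervalIntegrable (fun r => (s - r) ^ (-α) * g r) volume η s) :
    truncatedCaputo α v g η s = truncatedCaputo α v g ε s -
      ∫ r in η..ε, α * (s - r) ^ (-α - 1) * v r := by
  have h := (hv.mono le_rfl hηε hεs.le).integral_rpow_mul (α := α) hηε hεs
  have h1 : IntervalIntegrable (fun r => (s - r) ^ (-α) * g r) volume η ε := hg.mono_set (by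
    rw [uIcc_of_le hηε, uIcc_of_le (hηε.trans hεs.le)]
    exact Icc_subset_Icc_right hεs.le)
  have h2 : IntervalIntegrable (fun r => (s - r) ^ (-α) * g r) volume ε s := hg.mono_set (by
    rw [uIcc_of_le hεs.le, uIcc_of_le (hηε.trans hεs.le)]
    exact Icc_subset_Icc_left hηε)
  rw [truncatedCaputo, truncatedCaputo, ← intervalIntegral.integral_add_adjacent_intervals h1 h2, h]
  ring

theorem continuousOn_rpow_mul {α η ε s : ℝ} {v : ℝ → ℝ} (hεs : ε < s)
    (hv : ContinuousOn v (Icc η ε)) :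
    ContinuousOn (fun r => α * (s - r) ^ (-α - 1) * v r) (Icc η ε) :=
  (continuousOn_const.mul ((continuousOn_sub_rpow hεs).mono fun _ hr => hr.2)).mul hv

theorem truncatedCaputo_anti {α η ε s : ℝ} {v g : ℝ → ℝ} (hα : 0 < α) (hηε : η ≤ ε) (hεs : ε < s)
    (hv : HasTimeDeriv v g η s) (hv0 : ∀ r ∈ Icc η ε, 0 ≤ v r)
    (hg : IntervalIntegrable (fun r => (s - r) ^ (-α) * g r) volume η s) :
    truncatedCaputo α v g η s ≤ truncatedCaputo α v g ε s := by
  rw [truncatedCaputo_sub hηε hεs hv hg]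
  have : 0 ≤ ∫ r in η..ε, α * (s - r) ^ (-α - 1) * v r := by
    refine intervalIntegral.integral_nonneg hηε fun r hr => ?_
    have := Real.rpow_nonneg (show 0 ≤ s - r by linarith [hr.2]) (-α - 1)
    have := hv0 r hr
    positivity
  linarith

theorem truncatedCaputo_le_add {α η ε s C : ℝ} {v g : ℝ → ℝ} (hα : 0 < α) (hηε : η ≤ ε)
    (hεs : ε < s) (hv : HasTimeDeriv v g η s) (hvC : ∀ r ∈ Icc η ε, v r ≤ C)
    (hg : IntervalIntegrable (fun r => (s - r) ^ (-α) * g r) volume η s) :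
    truncatedCaputo α v g ε s ≤
      truncatedCaputo α v g η s + C * ((s - ε) ^ (-α) - (s - η) ^ (-α)) := by
  rw [truncatedCaputo_sub hηε hεs hv hg, ← integral_rpow_neg_sub_one hηε hεs,
    ← intervalIntegral.integral_const_mul]
  have : ∫ r in η..ε, α * (s - r) ^ (-α - 1) * v r ≤ ∫ r in η..ε, C * (α * (s - r) ^ (-α - 1)) := by
    have hc := continuousOn_rpow_mul (α := α) hεs ((hv.continuousOn (hηε.trans hεs.le)).mono
      (Icc_subset_Icc_right hεs.le))
    have hc1 := continuousOn_rpow_mul (α := α) (η := η) hεs (continuousOn_const (c := C))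
    rw [← uIcc_of_le hηε] at hc hc1
    simp_rw [mul_comm C]
    refine intervalIntegral.integral_mono_on hηε hc.intervalIntegrable hc1.intervalIntegrable
      fun r hr => ?_
    have := Real.rpow_nonneg (show 0 ≤ s - r by linarith [hr.2]) (-α - 1)
    exact mul_le_mul_of_nonneg_left (hvC r hr) (by positivity)
  linarith

theorem tendsto_intervalIntegral_left {f : ℝ → ℝ} {a s : ℝ} (has : a < s)
    (hf : IntervalIntegrable f volume a s) :
    Tendsto (fun b => ∫ r in a..b, f r) (𝓝[<] s) (𝓝 (∫ r in a..s, f r)) := by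
  have h := intervalIntegral.continuousOn_primitive_interval' hf left_mem_uIcc
  rw [uIcc_of_le has.le] at h
  refine (h s ⟨has.le, le_rfl⟩).tendsto.mono_left ?_
  rw [← nhdsWithin_Ioo_eq_nhdsLT has]
  exact nhdsWithin_mono _ Ioo_subset_Icc_self

/-- At a zero minimum the Caputo derivative is non-positive. -/
theorem truncatedCaputo_nonpos_of_zero {α a s : ℝ} {v g : ℝ → ℝ} (hα : 0 < α) (has : a < s)
    (hv : HasTimeDeriv v g a s) (hv0 : ∀ r ∈ Icc a s, 0 ≤ v r) (hvs : v s = 0)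
    (hg : IntervalIntegrable (fun r => (s - r) ^ (-α) * g r) volume a s) :
    truncatedCaputo α v g a s ≤ 0 := by
  have hga := hg.norm
  have hlim : Tendsto (fun b => (s - a) ^ (-α) * v a + (∫ r in a..b, (s - r) ^ (-α) * g r) -
      ((∫ r in a..s, ‖(s - r) ^ (-α) * g r‖) - ∫ r in a..b, ‖(s - r) ^ (-α) * g r‖)) (𝓝[<] s)
      (𝓝 (truncatedCaputo α v g a s)) := by
    have := ((tendsto_intervalIntegral_left has hg).const_add ((s - a) ^ (-α) * v a)).sub
      ((tendsto_intervalIntegral_left has hga).const_sub (∫ r in a..s, ‖(s - r) ^ (-α) * g r‖))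
    simpa [truncatedCaputo] using this
  refine le_of_tendsto hlim ?_
  filter_upwards [Ioo_mem_nhdsLT has] with b hb
  have hsub : uIcc b s ⊆ uIcc a s := by
    rw [uIcc_of_le hb.2.le, uIcc_of_le has.le]
    exact Icc_subset_Icc_left hb.1.le
  have hsub' : uIcc a b ⊆ uIcc a s := by
    rw [uIcc_of_le hb.1.le, uIcc_of_le has.le]
    exact Icc_subset_Icc_right hb.2.le
  have h1 := (hv.mono le_rfl hb.1.le hb.2.le).integral_rpow_mul (α := α) hb.1.le hb.2
  have h2 : 0 ≤ ∫ r in a..b, α * (s - r) ^ (-α - 1) * v r := by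
    refine intervalIntegral.integral_nonneg hb.1.le fun r hr => ?_
    have := Real.rpow_nonneg (show 0 ≤ s - r by linarith [hr.2, hb.2]) (-α - 1)
    have := hv0 r ⟨hr.1, hr.2.trans hb.2.le⟩
    positivity
  -- The boundary term at `b` vanishes as `b → s`: since `v s = 0`, `v b` is an integral of `-g`
  -- over `[b, s]`, where the weight is at least `(s - b) ^ (-α)`.
  have h3 : (s - b) ^ (-α) * v b ≤ ∫ r in b..s, ‖(s - r) ^ (-α) * g r‖ := by
    have hvb : v b = -∫ r in b..s, g r := by
      have := (hv.mono hb.1.le hb.2.le le_rfl).2 s ⟨hb.2.le, le_rfl⟩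
      linarith
    have hgb : IntervalIntegrable g volume b s := hv.1.mono_set hsub
    rw [hvb, ← intervalIntegral.integral_neg, ← intervalIntegral.integral_const_mul]
    refine intervalIntegral.integral_mono_on_of_le_Ioo hb.2.le (hgb.neg.const_mul _)
      (hga.mono_set hsub) fun r hr => ?_
    have hsr : 0 < s - r := sub_pos.2 hr.2
    have hp : (s - b) ^ (-α) ≤ (s - r) ^ (-α) :=
      Real.rpow_le_rpow_of_nonpos hsr (by linarith [hr.1]) (by linarith)
    have hp0 : 0 ≤ (s - b) ^ (-α) := Real.rpow_nonneg (by linarith [hb.2]) _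
    rw [norm_mul, Real.norm_eq_abs, Real.norm_eq_abs, abs_of_nonneg (hp0.trans hp)]
    exact (mul_le_mul_of_nonneg_left (neg_le_abs _) hp0).trans
      (mul_le_mul_of_nonneg_right hp (abs_nonneg _))
  have h4 := intervalIntegral.integral_add_adjacent_intervals (hga.mono_set hsub')
    (hga.mono_set hsub)
  linarith

/-- Truncating a non-negative barrier to `[ε, ∞)` increases its Caputo derivative. -/
theorem HasCaputoDerivAt.le_truncatedOp {α μ ε s w : ℝ} {v : ℝ → ℝ} (hα : 0 < α)
    (hv0 : ∀ r ∈ Icc 0 s, 0 ≤ v r) (hv : HasCaputoDerivAt α v s w) (hα1 : α < 1) (hε : 0 < ε)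
    (hεs : ε < s) : w + μ * v s ≤ truncatedOp α μ v (deriv v) ε s := by
  obtain ⟨g, hg, hlim⟩ := hv
  have hΓ := Real.Gamma_pos_of_pos (sub_pos.2 hα1)
  have hae := (hg ε ⟨hε, hεs⟩).1.ae_hasDerivAt hεs.le
  -- The derivative `g` supplied by the Caputo derivative depends on `s`; replacing it by `deriv v`
  -- makes one truncated operator serve all times.
  have hop : truncatedOp α μ v (deriv v) ε s = truncatedOp α μ v g ε s := by
    rw [truncatedOp, truncatedOp]
    congr 1
    refine intervalIntegral.integral_congr_ae ?_
    filter_upwards [hae, show ∀ᵐ r, r ≠ s by simp [ae_iff, measure_singleton]] with r hr hrs hr'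
    rw [uIoc_of_le hεs.le] at hr'
    rw [(hr ⟨hr'.1, lt_of_le_of_ne hr'.2 hrs⟩).deriv]
  rw [hop, truncatedOp_eq hεs.le (hg ε ⟨hε, hεs⟩).1 (hg ε ⟨hε, hεs⟩).2]
  refine add_le_add_left (le_of_tendsto hlim ?_) _
  filter_upwards [Ioo_mem_nhdsGT hε] with η hη
  have hηs : η < s := hη.2.trans hεs
  obtain ⟨h1, h2⟩ := hg η ⟨hη.1, hηs⟩
  simp only [smul_eq_mul] at h2 ⊢
  refine mul_le_mul_of_nonneg_left (le_trans ?_ (truncatedCaputo_anti hα hη.2.le hεs h1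
    (fun r hr => hv0 r ⟨hη.1.le.trans hr.1, hr.2.trans hεs.le⟩) h2)) (inv_pos.2 hΓ).le
  rw [truncatedCaputo]
  have hp : s ^ (-α) ≤ (s - η) ^ (-α) :=
    Real.rpow_le_rpow_of_nonpos (sub_pos.2 hηs) (by linarith [hη.1]) (by linarith)
  have hp0 : 0 ≤ s ^ (-α) := Real.rpow_nonneg (by linarith) _
  have h5 := hv0 η ⟨hη.1.le, hηs.le⟩
  have h6 := hv0 0 ⟨le_rfl, by linarith⟩
  -- Here `0 ≤ v 0` permits dropping the initial value, even when `v` jumps at `0`.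
  have h7 : s ^ (-α) * (v η - v 0) ≤ (s - η) ^ (-α) * v η :=
    (mul_le_mul_of_nonneg_left (by linarith) hp0).trans (mul_le_mul_of_nonneg_right hp h5)
  linarith

/-! ### The Caputo derivative of the norm of a Hilbert space valued function -/

theorem _root_.MeasureTheory.MemLp.exists_ae_norm_le {X Y : Type*}
    [NormedAddCommGroup X] [MeasurableSpace Y] {ν : Measure Y}
    {f : Y → X} (hf : MemLp f ∞ ν) : ∃ C : ℝ, 0 ≤ C ∧ ∀ᵐ x ∂ν, ‖f x‖ ≤ C := by
  have h := hf.2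
  rw [eLpNorm_exponent_top] at h
  refine ⟨(eLpNormEssSup f ν).toReal, ENNReal.toReal_nonneg, ?_⟩
  filter_upwards [ae_le_eLpNormEssSup (f := f) (μ := ν)] with x hx
  rw [← toReal_enorm]
  exact ENNReal.toReal_mono h.ne hx

section Banach

variable {X : Type*} [NormedAddCommGroup X] [NormedSpace ℝ X]

theorem MemW1Inf.sub {v w : ℝ → X} {a b : ℝ} (hv : MemW1Inf v a b) (hw : MemW1Inf w a b)
    (hab : a ≤ b) : MemW1Inf (fun s => v s - w s) a b := by
  obtain ⟨g, hg, hvg⟩ := hv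
  obtain ⟨h, hh, hwh⟩ := hw
  exact ⟨fun s => g s - h s, hg.sub hh, hvg.sub hwh hab⟩

theorem TimeRegular.sub {T : ℝ} {v w : ℝ → X} (hv : TimeRegular T v) (hw : TimeRegular T w) :
    TimeRegular T fun s => v s - w s := fun ε t hε hεt htT =>
  ⟨(hv ε t hε hεt htT).1.sub (hw ε t hε hεt htT).1,
    (hv ε t hε hεt htT).2.sub (hw ε t hε hεt htT).2 hεt.le⟩

theorem MemW1Inf.exists_lipschitzOnWith {v : ℝ → X} {a b : ℝ} (hv : MemW1Inf v a b) :
    ∃ K : NNReal, LipschitzOnWith K v (Icc a b) := by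
  obtain ⟨g, hg, hvg⟩ := hv
  obtain ⟨C, hC0, hC⟩ := hg.exists_ae_norm_le
  rw [restrict_Ioo_eq_restrict_Ioc, ae_restrict_iff' measurableSet_Ioc] at hC
  refine ⟨⟨C, hC0⟩, LipschitzOnWith.of_dist_le_mul fun x hx y hy => ?_⟩
  have hab : a ≤ b := hx.1.trans hx.2
  have hsub : ∀ z ∈ Icc a b, IntervalIntegrable g volume a z := fun z hz => hvg.1.mono_set (by
    rw [uIcc_of_le hz.1, uIcc_of_le hab]
    exact Icc_subset_Icc_right hz.2)
  rw [dist_eq_norm, hvg.2 x hx, hvg.2 y hy, add_sub_add_left_eq_sub,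
    intervalIntegral.integral_interval_sub_left (hsub x hx) (hsub y hy), Real.dist_eq]
  refine intervalIntegral.norm_integral_le_of_norm_le_const_ae ?_
  filter_upwards [hC] with r hr hrxy
  exact hr ⟨(le_min hy.1 hx.1).trans_lt hrxy.1, hrxy.2.trans (max_le hy.2 hx.2)⟩

theorem TimeRegular.continuousOn {T : ℝ} {v : ℝ → X} (hv : TimeRegular T v) {ε : ℝ} (hε : 0 < ε)
    (hεT : ε < T) : ContinuousOn v (Icc ε T) := by
  obtain ⟨K, hK⟩ := (hv ε T hε hεT le_rfl).2.exists_lipschitzOnWith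
  exact hK.continuousOn

theorem TimeRegular.exists_bound {T : ℝ} (hT : 0 < T) {v : ℝ → X} (hv : TimeRegular T v) :
    ∃ C : ℝ, 0 ≤ C ∧ ∀ s ∈ Ioc 0 T, ‖v s‖ ≤ C := by
  obtain ⟨C, hC0, hC⟩ := (hv (T / 2) T (by linarith) (by linarith) le_rfl).1.exists_ae_norm_le
  refine ⟨C, hC0, fun s hs => ?_⟩
  have hcont : Tendsto (fun r => ‖v r‖) (𝓝[<] s) (𝓝 ‖v s‖) := by
    have h := (hv.continuousOn (half_pos hs.1) (by linarith [hs.1, hs.2])).norm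
    refine (h s ⟨by linarith [hs.1], hs.2⟩).tendsto.mono_left ?_
    rw [← nhdsWithin_Ioo_eq_nhdsLT (show s / 2 < s by linarith [hs.1])]
    exact nhdsWithin_mono _ (Ioo_subset_Icc_self.trans (Icc_subset_Icc_right hs.2))
  -- If the essential bound failed at all points just to the left of `s`, it would fail on a set of
  -- positive measure.
  refine le_of_tendsto_of_frequently hcont fun hbad => ?_
  obtain ⟨l, hl, hsub⟩ := mem_nhdsLT_iff_exists_Ioo_subset.1 hbad
  have hl' : max l 0 < s := max_lt hl hs.1
  rw [ae_restrict_iff' measurableSet_Ioo, ae_iff] at hC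
  have h0 : volume (Ioo (max l 0) s) = 0 := by
    refine measure_mono_null (t := {r | ¬(r ∈ Ioo 0 T → ‖v r‖ ≤ C)}) (fun r hr hr' => ?_) hC
    exact hsub ⟨(le_max_left _ _).trans_lt hr.1, hr.2⟩
      (hr' ⟨(le_max_right _ _).trans_lt hr.1, hr.2.trans_le hs.2⟩)
  rw [Real.volume_Ioo, ENNReal.ofReal_eq_zero] at h0
  linarith

theorem HasCaputoDerivAt.sub {α t : ℝ} (ht : 0 < t) {v v' : ℝ → X} {w w' : X} (hv : HasCaputoDerivAt α v t w)
    (hv' : HasCaputoDerivAt α v' t w') :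
    HasCaputoDerivAt α (fun s => v s - v' s) t (w - w') := by
  obtain ⟨g, hg, hl⟩ := hv
  obtain ⟨g', hg', hl'⟩ := hv'
  refine ⟨fun s => g s - g' s, fun ε hε => ⟨(hg ε hε).1.sub (hg' ε hε).1 hε.2.le, ?_⟩, ?_⟩
  · simp_rw [smul_sub]
    exact (hg ε hε).2.sub (hg' ε hε).2
  · refine (hl.sub hl').congr' ?_
    filter_upwards [Ioo_mem_nhdsGT ht] with ε hε
    simp_rw [smul_sub]
    rw [intervalIntegral.integral_sub (hg ε hε).2 (hg' ε hε).2]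
    simp only [smul_add, smul_sub]
    abel

theorem HasCaputoDerivAt.clm_comp [CompleteSpace X] {α t : ℝ} (ht : 0 < t) {v : ℝ → X} {w : X}
    (hv : HasCaputoDerivAt α v t w) (L : X →L[ℝ] ℝ) :
    HasCaputoDerivAt α (fun s => L (v s)) t (L w) := by
  obtain ⟨g, hg, hl⟩ := hv
  have hint : ∀ ε ∈ Ioo 0 t,
      IntervalIntegrable (fun s => (t - s) ^ (-α) • L (g s)) volume ε t := by
    intro ε hε
    have h := (hg ε hε).2
    simp_rw [← map_smul]
    exact ⟨L.integrable_comp h.1, L.integrable_comp h.2⟩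
  refine ⟨fun s => L (g s), fun ε hε => ⟨(hg ε hε).1.clm_comp L hε.2.le, hint ε hε⟩, ?_⟩
  refine ((L.continuous.tendsto w).comp hl).congr' ?_
  filter_upwards [Ioo_mem_nhdsGT ht] with ε hε
  simp only [Function.comp_apply, map_smul, map_add, map_sub]
  rw [← L.intervalIntegral_comp_comm (hg ε hε).2]
  simp only [map_smul]

end Banach

theorem intervalIntegrable_rpow_mul_deriv {v : ℝ → ℝ} {K : NNReal} {a s α : ℝ} (hα1 : α < 1)
    (has : a ≤ s) (hv : LipschitzOnWith K v (Icc a s)) :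
    IntervalIntegrable (fun r => (s - r) ^ (-α) * deriv v r) volume a s := by
  have hpow : IntervalIntegrable (fun r => (s - r) ^ (-α)) volume a s :=
    intervalIntegrable_sub_rpow (by linarith)
  rw [intervalIntegrable_iff_integrableOn_Ioc_of_le has] at hpow ⊢
  refine Integrable.mul_bdd (c := K) hpow (measurable_deriv v).aestronglyMeasurable ?_
  rw [← restrict_Ioo_eq_restrict_Ioc]
  filter_upwards [ae_restrict_mem measurableSet_Ioo] with r hr
  exact norm_deriv_le_of_lipschitzOn (Icc_mem_nhds hr.1 hr.2) hv

section Hilbert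

variable {H : Type*} [NormedAddCommGroup H] [InnerProductSpace ℝ H] [CompleteSpace H]

/-- The pointwise inequality `‖v‖ D_t^α ‖v‖ ≤ ⟨D_t^α v, v⟩`, with `D_t^α ‖v‖` truncated at `ε` and
the value of `v` at the initial time replaced by `0`. -/
theorem norm_mul_truncatedCaputo_norm_le_inner {α T C : ℝ} {v : ℝ → H} (hα0 : 0 < α) (hα1 : α < 1)
    (hv : TimeRegular T v) (hC : ∀ s ∈ Ioc 0 T, ‖v s‖ ≤ C) {s ε : ℝ} (hε : 0 < ε) (hεs : ε < s)
    (hsT : s ≤ T) {w : H} (hw : HasCaputoDerivAt α v s w) :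
    ‖v s‖ * ((Real.Gamma (1 - α))⁻¹ * (truncatedCaputo α (fun r => ‖v r‖)
      (deriv fun r => ‖v r‖) ε s - C * ((s - ε) ^ (-α) - s ^ (-α)))) ≤
      inner ℝ (w + ((Real.Gamma (1 - α))⁻¹ * s ^ (-α)) • v 0) (v s) := by
  set φ : ℝ → ℝ := fun r => ‖v r‖ with hφ
  have hs0 : 0 < s := hε.trans hεs
  have hC0 : 0 ≤ C := (norm_nonneg _).trans (hC s ⟨hs0, hsT⟩)
  have hΓ := Real.Gamma_pos_of_pos (sub_pos.2 hα1)
  obtain ⟨g, hg, hlim⟩ := hw.clm_comp hs0 (innerSL ℝ (v s))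
  simp only [smul_eq_mul, innerSL_apply_apply] at hg hlim
  -- The multiple of `v 0` removes the initial value from the improper integral.
  have hlim' : Tendsto (fun η => (Real.Gamma (1 - α))⁻¹ * (s ^ (-α) * inner ℝ (v s) (v η) +
      ∫ r in η..s, (s - r) ^ (-α) * g r)) (𝓝[>] 0)
      (𝓝 (inner ℝ (w + ((Real.Gamma (1 - α))⁻¹ * s ^ (-α)) • v 0) (v s))) := by
    have h := hlim.add_const ((Real.Gamma (1 - α))⁻¹ * s ^ (-α) * inner ℝ (v s) (v 0))
    rw [real_inner_comm, inner_add_right, inner_smul_right]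
    refine h.congr fun η => ?_
    ring
  -- The subtracted term pays for replacing the weight `s ^ (-α)` of the initial term by `(s - η) ^
  -- (-α)`; it vanishes as `η → 0`.
  have hsmall : Tendsto (fun η => ‖v s‖ * ((Real.Gamma (1 - α))⁻¹ * (truncatedCaputo α φ
      (deriv φ) ε s - C * ((s - ε) ^ (-α) - s ^ (-α)))) -
      (Real.Gamma (1 - α))⁻¹ * (((s - η) ^ (-α) - s ^ (-α)) * (C * C))) (𝓝[>] 0)
      (𝓝 (‖v s‖ * ((Real.Gamma (1 - α))⁻¹ * (truncatedCaputo α φ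
      (deriv φ) ε s - C * ((s - ε) ^ (-α) - s ^ (-α)))))) := by
    have hc : ContinuousAt (fun η : ℝ => (s - η) ^ (-α)) 0 :=
      (continuousAt_const.sub continuousAt_id).rpow_const (Or.inl (by simp [hs0.ne']))
    have h1 := hc.tendsto.mono_left (nhdsWithin_le_nhds (s := Ioi 0))
    have h2 := (((h1.sub_const (s ^ (-α))).mul_const (C * C)).const_mul
      (Real.Gamma (1 - α))⁻¹).const_sub (‖v s‖ * ((Real.Gamma (1 - α))⁻¹ * (truncatedCaputo α φ
      (deriv φ) ε s - C * ((s - ε) ^ (-α) - s ^ (-α)))))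
    simpa using h2
  refine le_of_tendsto_of_tendsto hsmall hlim' ?_
  filter_upwards [Ioo_mem_nhdsGT hε] with η hη
  have hηs : η < s := hη.2.trans hεs
  obtain ⟨K, hK⟩ := (hv η s hη.1 hηs hsT).2.exists_lipschitzOnWith
  have hφK : LipschitzOnWith K φ (Icc η s) := by
    have := lipschitzWith_one_norm.comp_lipschitzOnWith hK
    rwa [one_mul] at this
  have hφd := hφK.hasTimeDeriv_deriv hηs.le
  have hφi := intervalIntegrable_rpow_mul_deriv hα1 hηs.le hφK
  obtain ⟨hyd, hyi⟩ := hg η ⟨hη.1, hηs⟩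
  have hcd : HasTimeDeriv (fun r => ‖v s‖ * φ r) (fun r => ‖v s‖ * deriv φ r) η s := by
    refine ⟨hφd.1.const_mul _, fun r hr => ?_⟩
    rw [intervalIntegral.integral_const_mul, ← mul_add, ← hφd.2 r hr]
  -- By Cauchy–Schwarz `‖v s‖ * ‖v r‖ - ⟨v s, v r⟩` is non-negative, with a zero at `r = s`.
  have hz := truncatedCaputo_nonpos_of_zero hα0 hηs (hcd.sub hyd hηs.le)
    (fun r _ => sub_nonneg.2 (real_inner_le_norm (v s) (v r)))
    (by simp [hφ, sq])
    (((hφi.const_mul ‖v s‖).sub hyi).congr fun r _ => by ring)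
  have hz2 : ‖v s‖ * truncatedCaputo α φ (deriv φ) η s ≤
      (s - η) ^ (-α) * inner ℝ (v s) (v η) + ∫ r in η..s, (s - r) ^ (-α) * g r := by
    have e : ∀ r, (s - r) ^ (-α) * (‖v s‖ * deriv φ r - g r) =
        ‖v s‖ * ((s - r) ^ (-α) * deriv φ r) - (s - r) ^ (-α) * g r := fun r => by ring
    rw [truncatedCaputo] at hz ⊢
    simp_rw [e] at hz
    rw [intervalIntegral.integral_sub (hφi.const_mul _) hyi,
      intervalIntegral.integral_const_mul] at hz
    linarith
  have hle := truncatedCaputo_le_add (C := C) hα0 hη.2.le hεs hφd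
    (fun r hr => hC r ⟨hη.1.trans_le hr.1, (hr.2.trans hεs.le).trans hsT⟩) hφi
  have hp : s ^ (-α) ≤ (s - η) ^ (-α) :=
    Real.rpow_le_rpow_of_nonpos (sub_pos.2 hηs) (by linarith [hη.1]) (by linarith)
  have hin : inner ℝ (v s) (v η) ≤ C * C := (real_inner_le_norm _ _).trans
    (mul_le_mul (hC s ⟨hs0, hsT⟩) (hC η ⟨hη.1, hηs.le.trans hsT⟩) (norm_nonneg _) hC0)
  have h1 := mul_le_mul_of_nonneg_left hin (sub_nonneg.2 hp)
  have h2 : C * ((s - ε) ^ (-α) - (s - η) ^ (-α)) ≤ C * ((s - ε) ^ (-α) - s ^ (-α)) :=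
    mul_le_mul_of_nonneg_left (by linarith) hC0
  have h3 : ‖v s‖ * (truncatedCaputo α φ (deriv φ) ε s - C * ((s - ε) ^ (-α) - s ^ (-α))) ≤
      ‖v s‖ * truncatedCaputo α φ (deriv φ) η s :=
    mul_le_mul_of_nonneg_left (by linarith) (norm_nonneg _)
  rw [mul_left_comm, ← mul_sub]
  exact mul_le_mul_of_nonneg_left (by linarith) (inv_pos.2 hΓ).le

/-- The scalar differential inequality satisfied by the norm of the error. -/
theorem truncatedOp_norm_le {α μ T C ρ : ℝ} {v : ℝ → H} (hα0 : 0 < α) (hα1 : α < 1)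
    (hv : TimeRegular T v) (hC : ∀ s ∈ Ioc 0 T, ‖v s‖ ≤ C) {s ε : ℝ} (hε : 0 < ε) (hεs : ε < s)
    (hsT : s ≤ T) (hρ : 0 ≤ ρ) {w : H} (hw : HasCaputoDerivAt α v s w)
    (henergy : inner ℝ (w + ((Real.Gamma (1 - α))⁻¹ * s ^ (-α)) • v 0) (v s) + μ * ‖v s‖ ^ 2 ≤
      ρ * ‖v s‖) :
    truncatedOp α μ (fun r => ‖v r‖) (deriv fun r => ‖v r‖) ε s ≤
      ρ + C * (resolventSymbol α μ (s - ε) - resolventSymbol α μ s) := by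
  set φ : ℝ → ℝ := fun r => ‖v r‖ with hφ
  have hs0 : 0 < s := hε.trans hεs
  have hC0 : 0 ≤ C := (norm_nonneg _).trans (hC s ⟨hs0, hsT⟩)
  have hΓ := inv_pos.2 (Real.Gamma_pos_of_pos (sub_pos.2 hα1))
  obtain ⟨K, hK⟩ := (hv ε s hε hεs hsT).2.exists_lipschitzOnWith
  have hφK : LipschitzOnWith K φ (Icc ε s) := by
    have := lipschitzWith_one_norm.comp_lipschitzOnWith hK
    rwa [one_mul] at this
  have hφd := hφK.hasTimeDeriv_deriv hεs.le
  have hφi := intervalIntegrable_rpow_mul_deriv hα1 hεs.le hφK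
  have hsym : resolventSymbol α μ (s - ε) - resolventSymbol α μ s =
      (Real.Gamma (1 - α))⁻¹ * ((s - ε) ^ (-α) - s ^ (-α)) := by
    simp only [resolventSymbol]
    ring
  rw [truncatedOp_eq hεs.le hφd hφi, hsym]
  -- Where `v s = 0` the energy inequality is void, but the norm then has a zero minimum at `s`.
  rcases (norm_nonneg (v s)).eq_or_lt with h0 | hpos
  · have hn := truncatedCaputo_nonpos_of_zero hα0 hεs hφd (fun r _ => norm_nonneg _) h0.symm hφi
    have hp : s ^ (-α) ≤ (s - ε) ^ (-α) :=
      Real.rpow_le_rpow_of_nonpos (sub_pos.2 hεs) (by linarith) (by linarith)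
    have h1 : 0 ≤ C * ((Real.Gamma (1 - α))⁻¹ * ((s - ε) ^ (-α) - s ^ (-α))) :=
      mul_nonneg hC0 (mul_nonneg hΓ.le (sub_nonneg.2 hp))
    have h2 := mul_nonpos_of_nonneg_of_nonpos hΓ.le hn
    have h3 : φ s = 0 := h0.symm
    rw [h3]
    linarith
  · have h := norm_mul_truncatedCaputo_norm_le_inner hα0 hα1 hv hC hε hεs hsT hw
    refine le_of_mul_le_mul_left ?_ hpos
    have : φ s = ‖v s‖ := rfl
    rw [this]
    linarith

end Hilbert

/-! ### Comparison principles for the fractional operator -/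

theorem ofReal_integral_le_lintegral_ofReal {Y : Type*} [MeasurableSpace Y] {ν : Measure Y}
    (f : Y → ℝ) : ENNReal.ofReal (∫ x, f x ∂ν) ≤ ∫⁻ x, ENNReal.ofReal (f x) ∂ν := by
  by_cases hf : Integrable f ν
  · rw [integral_eq_lintegral_pos_part_sub_lintegral_neg_part hf]
    refine (ENNReal.ofReal_le_ofReal (sub_le_self _ ENNReal.toReal_nonneg)).trans
      ENNReal.ofReal_toReal_le
  · simp [integral_undef hf]

theorem resolventSymbol_sub_nonneg {α μ a s : ℝ} (hα0 : 0 < α) (hα1 : α < 1) (ha : 0 < a)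
    (has : a < s) : 0 ≤ resolventSymbol α μ (s - a) - resolventSymbol α μ s := by
  have hp : s ^ (-α) ≤ (s - a) ^ (-α) :=
    Real.rpow_le_rpow_of_nonpos (sub_pos.2 has) (by linarith) (by linarith)
  have hΓ := inv_pos.2 (Real.Gamma_pos_of_pos (sub_pos.2 hα1))
  rw [resolventSymbol, resolventSymbol, add_sub_add_right_eq_sub, ← mul_sub]
  exact mul_nonneg hΓ.le (sub_nonneg.2 hp)

/-- A subsolution is bounded by the inverse operator applied to the right-hand side. -/
theorem ofReal_le_caputoInv {α μ C t : ℝ} {φ g ρ : ℝ → ℝ} (hα0 : 0 < α) (hα1 : α < 1)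
    (ht : 0 < t) (hC : 0 ≤ C) (hd : ∀ ε ∈ Ioo 0 t, HasTimeDeriv φ g ε t)
    (hop : ∀ ε ∈ Ioo 0 t, ∀ s ∈ Ioo ε t, truncatedOp α μ φ g ε s ≤
      ρ s + C * (resolventSymbol α μ (s - ε) - resolventSymbol α μ s)) :
    ENNReal.ofReal (φ t) ≤ caputoInv α μ (fun s => ENNReal.ofReal (ρ s)) t := by
  have hlim := (ENNReal.tendsto_ofReal ((tendsto_integral_fracKernel_mul_resolventSymbol_sub
    (μ := μ) hα0 hα1 ht).const_mul C)).const_add (caputoInv α μ (fun s => ENNReal.ofReal (ρ s)) t)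
  rw [mul_zero, ENNReal.ofReal_zero, add_zero] at hlim
  refine ge_of_tendsto hlim ?_
  filter_upwards [Ioo_mem_nhdsGT ht] with ε hε
  have hI := (intervalIntegrable_fracKernel_mul_resolventSymbol_sub (μ := μ) hα0 hα1 hε.1
    hε.2).const_mul C
  have hIoo := hI.1
  rw [IntegrableOn, ← restrict_Ioo_eq_restrict_Ioc] at hIoo
  rw [← integral_fracKernel_mul_truncatedOp (μ := μ) hα0 hα1 hε.2 (hd ε hε),
    ← intervalIntegral.integral_const_mul, intervalIntegral.integral_of_le hε.2.le,
    intervalIntegral.integral_of_le hε.2.le, ← restrict_Ioo_eq_restrict_Ioc]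
  refine (ofReal_integral_le_lintegral_ofReal _).trans ?_
  have hpos : ∀ s ∈ Ioo ε t, 0 ≤ C * (fracKernel α α (-μ) (t - s) *
      (resolventSymbol α μ (s - ε) - resolventSymbol α μ s)) := fun s hs =>
    mul_nonneg hC (mul_nonneg (fracKernel_pos hα0 hα1 (sub_pos.2 hs.2)).le
      (resolventSymbol_sub_nonneg hα0 hα1 hε.1 hs.1))
  rw [ofReal_integral_eq_lintegral_ofReal hIoo
    ((ae_restrict_iff' measurableSet_Ioo).2 (ae_of_all _ hpos))]
  calc ∫⁻ s in Ioo ε t, ENNReal.ofReal (fracKernel α α (-μ) (t - s) * truncatedOp α μ φ g ε s)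
      ≤ ∫⁻ s in Ioo ε t, (ENNReal.ofReal (fracKernel α α (-μ) (t - s)) * ENNReal.ofReal (ρ s) +
          ENNReal.ofReal (C * (fracKernel α α (-μ) (t - s) *
            (resolventSymbol α μ (s - ε) - resolventSymbol α μ s)))) := by
        refine setLIntegral_mono' measurableSet_Ioo fun s hs => ?_
        have hk := (fracKernel_pos (c := -μ) hα0 hα1 (sub_pos.2 hs.2)).le
        rw [← ENNReal.ofReal_mul hk]
        refine (ENNReal.ofReal_le_ofReal ?_).trans ENNReal.ofReal_add_le
        have := mul_le_mul_of_nonneg_left (hop ε hε s hs) hk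
        linarith
    -- Measurability is needed only for the second summand; nothing is known about `ρ`.
    _ = (∫⁻ s in Ioo ε t, ENNReal.ofReal (fracKernel α α (-μ) (t - s)) * ENNReal.ofReal (ρ s)) +
          ∫⁻ s in Ioo ε t, ENNReal.ofReal (C * (fracKernel α α (-μ) (t - s) *
            (resolventSymbol α μ (s - ε) - resolventSymbol α μ s))) :=
        lintegral_add_right' _ hIoo.aestronglyMeasurable.aemeasurable.ennreal_ofReal
    _ ≤ _ := by
        gcongr
        exact lintegral_mono_set (Ioo_subset_Ioo_left hε.1.le)

/-- A subsolution is bounded by a non-negative supersolution. -/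
theorem le_of_le_caputo_barrier {α μ C t : ℝ} {φ g ρ B DB : ℝ → ℝ} (hα0 : 0 < α) (hα1 : α < 1)
    (ht : 0 < t) (hd : ∀ ε ∈ Ioo 0 t, HasTimeDeriv φ g ε t)
    (hop : ∀ ε ∈ Ioo 0 t, ∀ s ∈ Ioo ε t, truncatedOp α μ φ g ε s ≤
      ρ s + C * (resolventSymbol α μ (s - ε) - resolventSymbol α μ s))
    (hB0 : ∀ s ∈ Icc 0 t, 0 ≤ B s) (hB : ∀ s ∈ Ioc 0 t, HasCaputoDerivAt α B s (DB s))
    (hρ : ∀ s ∈ Ioo 0 t, ρ s ≤ DB s + μ * B s) : φ t ≤ B t := by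
  have hlim := ((tendsto_integral_fracKernel_mul_resolventSymbol_sub
    (μ := μ) hα0 hα1 ht).const_mul C).const_add (B t)
  rw [mul_zero, add_zero] at hlim
  refine ge_of_tendsto hlim ?_
  filter_upwards [Ioo_mem_nhdsGT ht] with ε hε
  have hI := (intervalIntegrable_fracKernel_mul_resolventSymbol_sub (μ := μ) hα0 hα1 hε.1
    hε.2).const_mul C
  obtain ⟨gB, hgB, -⟩ := hB t ⟨ht, le_rfl⟩
  have hBd : HasTimeDeriv B (deriv B) ε t := by
    refine (hgB ε hε).1.congr_deriv hε.2.le ?_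
    filter_upwards [(hgB ε hε).1.ae_hasDerivAt hε.2.le] with r hr hr'
    exact (hr hr').deriv.symm
  have hBi := intervalIntegrable_fracKernel_mul_truncatedOp (μ := μ) hα0 hα1 hε.2 hBd
  rw [← integral_fracKernel_mul_truncatedOp (μ := μ) hα0 hα1 hε.2 (hd ε hε),
    ← integral_fracKernel_mul_truncatedOp (μ := μ) hα0 hα1 hε.2 hBd,
    ← intervalIntegral.integral_const_mul, ← intervalIntegral.integral_add hBi hI]
  refine intervalIntegral.integral_mono_on_of_le_Ioo hε.2.le
    (intervalIntegrable_fracKernel_mul_truncatedOp hα0 hα1 hε.2 (hd ε hε)) (hBi.add hI)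
    fun s hs => ?_
  have hk := (fracKernel_pos (c := -μ) hα0 hα1 (sub_pos.2 hs.2)).le
  have hs0 : 0 < s := hε.1.trans hs.1
  have h1 := (hB s ⟨hs0, hs.2.le⟩).le_truncatedOp (μ := μ) hα0
    (fun r hr => hB0 r ⟨hr.1, hr.2.trans hs.2.le⟩) hα1 hε.1 hs.1
  have h2 := (hop ε hε s hs).trans (add_le_add_left ((hρ s ⟨hs0, hs.2⟩).trans h1) _)
  have := mul_le_mul_of_nonneg_left h2 hk
  linarith

/-! ### The energy inequality for the elliptic operator -/

section Elliptic

variable {d : ℕ} {Ω : Set (Space d)}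

theorem _root_.MeasureTheory.MemLp.euclidean_apply {ν : Measure (Space d)} {V : Space d → Space d}
    (hV : MemLp V 2 ν) (i : Fin d) : MemLp (fun x => V x i) 2 ν :=
  (EuclideanSpace.proj i : Space d →L[ℝ] ℝ).comp_memLp' hV

/-- The zeroth-order part `Σᵢ bᵢ Vᵢ + c v` of the pairing. -/
noncomputable def EllipticOperator.lowerPart (L : EllipticOperator Ω) (v : Space d → ℝ)
    (V : Space d → Space d) (x : Space d) : ℝ :=
  (∑ i, L.b x i * V x i) + L.c x * v x

/-- The flux `Σⱼ aᵢⱼ Vⱼ + pᵢ v` of the pairing. -/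
noncomputable def EllipticOperator.flux (L : EllipticOperator Ω) (v : Space d → ℝ)
    (V : Space d → Space d) (x : Space d) : Space d :=
  WithLp.toLp 2 fun i => (∑ j, L.a x i j * V x j) + L.p x i * v x

theorem EllipticOperator.memLp_lowerPart (L : EllipticOperator Ω) {v : Space d → ℝ}
    {V : Space d → Space d} (hv : MemLp v 2 (volume.restrict Ω))
    (hV : MemLp V 2 (volume.restrict Ω)) : MemLp (L.lowerPart v V) 2 (volume.restrict Ω) :=
  (memLp_finsetSum _ fun i _ => (hV.euclidean_apply i).mul (L.b_mem i)).add (hv.mul L.c_mem)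

theorem EllipticOperator.memLp_flux (L : EllipticOperator Ω) {v : Space d → ℝ}
    {V : Space d → Space d} (hv : MemLp v 2 (volume.restrict Ω))
    (hV : MemLp V 2 (volume.restrict Ω)) : MemLp (L.flux v V) 2 (volume.restrict Ω) := by
  refine MemLp.of_eval_piLp fun i => ?_
  exact (memLp_finsetSum _ fun j _ => (hV.euclidean_apply j).mul (L.a_mem i j)).add
    (hv.mul (L.p_mem i))

/-- Writing the pairing as inner products with fixed `L_2` elements makes it continuous in `(w, W)`,
so identities for test functions extend to `H¹₀`. -/
theorem EllipticOperator.pairing_eq_inner (L : EllipticOperator Ω) {v w : Space d → ℝ}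
    {V W : Space d → Space d} (hv : MemLp v 2 (volume.restrict Ω))
    (hV : MemLp V 2 (volume.restrict Ω)) (w' : L2 Ω) (W' : L2Vec Ω)
    (hw : w' =ᵐ[volume.restrict Ω] w) (hW : W' =ᵐ[volume.restrict Ω] W) :
    L.pairing v V w W = inner ℝ (L.memLp_lowerPart hv hV).toLp w' +
      inner ℝ (L.memLp_flux hv hV).toLp W' := by
  rw [L2.inner_def, L2.inner_def, ← integral_add (L2.integrable_inner _ _)
    (L2.integrable_inner _ _)]
  refine integral_congr_ae ?_
  filter_upwards [hw, hW, (L.memLp_lowerPart hv hV).coeFn_toLp,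
    (L.memLp_flux hv hV).coeFn_toLp] with x h1 h2 h3 h4
  rw [h1, h2, h3, h4]
  simp only [lowerPart, flux, PiLp.inner_apply, RCLike.inner_apply, conj_trivial, mul_add,
    Finset.mul_sum, Finset.sum_add_distrib]
  have e1 : ∑ i, ∑ j, L.a x i j * V x j * W x i = ∑ i, ∑ j, W x i * (L.a x i j * V x j) :=
    Finset.sum_congr rfl fun i _ => Finset.sum_congr rfl fun j _ => by ring
  have e2 : ∑ i, L.p x i * v x * W x i = ∑ i, W x i * (L.p x i * v x) :=
    Finset.sum_congr rfl fun i _ => by ring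
  have e3 : ∑ i, L.b x i * V x i * w x = ∑ i, w x * (L.b x i * V x i) :=
    Finset.sum_congr rfl fun i _ => by ring
  rw [e1, e2, e3]
  ring

theorem EllipticOperator.toLp_lowerPart_sub (L : EllipticOperator Ω) (v v' : L2 Ω)
    (V V' : L2Vec Ω) :
    (L.memLp_lowerPart (Lp.memLp (v - v')) (Lp.memLp (V - V'))).toLp =
      (L.memLp_lowerPart (Lp.memLp v) (Lp.memLp V)).toLp -
        (L.memLp_lowerPart (Lp.memLp v') (Lp.memLp V')).toLp := by
  rw [← MemLp.toLp_sub]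
  refine MemLp.toLp_congr _ _ ?_
  filter_upwards [Lp.coeFn_sub v v', Lp.coeFn_sub V V'] with x h1 h2
  simp only [lowerPart, Pi.sub_apply, h1, h2, PiLp.sub_apply, mul_sub, Finset.sum_sub_distrib]
  ring

theorem EllipticOperator.toLp_flux_sub (L : EllipticOperator Ω) (v v' : L2 Ω) (V V' : L2Vec Ω) :
    (L.memLp_flux (Lp.memLp (v - v')) (Lp.memLp (V - V'))).toLp =
      (L.memLp_flux (Lp.memLp v) (Lp.memLp V)).toLp -
        (L.memLp_flux (Lp.memLp v') (Lp.memLp V')).toLp := by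
  rw [← MemLp.toLp_sub]
  refine MemLp.toLp_congr _ _ ?_
  filter_upwards [Lp.coeFn_sub v v', Lp.coeFn_sub V V'] with x h1 h2
  ext i
  simp only [flux, Pi.sub_apply, h1, h2, PiLp.sub_apply, mul_sub, Finset.sum_sub_distrib]
  ring

theorem IsTestFunction.sub {φ ψ : Space d → ℝ} (hφ : IsTestFunction Ω φ)
    (hψ : IsTestFunction Ω ψ) : IsTestFunction Ω (φ - ψ) :=
  ⟨hφ.1.sub hψ.1, hφ.2.1.sub hψ.2.1,
    (tsupport_sub φ ψ).trans (union_subset hφ.2.2 hψ.2.2)⟩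

theorem IsTestFunction.gradient_sub {φ ψ : Space d → ℝ} (hφ : IsTestFunction Ω φ)
    (hψ : IsTestFunction Ω ψ) : gradient (φ - ψ) = gradient φ - gradient ψ := by
  ext1 x
  have h1 : DifferentiableAt ℝ φ x := hφ.1.differentiable (by simp) x
  have h2 : DifferentiableAt ℝ ψ x := hψ.1.differentiable (by simp) x
  simp only [gradient, Pi.sub_apply, fderiv_sub h1 h2, map_sub]

theorem sub_mem_H10Graph {p q : L2 Ω × L2Vec Ω} (hp : p ∈ H10Graph Ω) (hq : q ∈ H10Graph Ω) :
    p - q ∈ H10Graph Ω := by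
  refine map_mem_closure₂ continuous_sub hp hq ?_
  rintro p ⟨φ, hφ, h1, h2⟩ q ⟨ψ, hψ, h3, h4⟩
  refine ⟨φ - ψ, hφ.sub hψ, ?_, ?_⟩
  · exact (Lp.coeFn_sub p.1 q.1).trans (h1.sub h3)
  · rw [hφ.gradient_sub hψ]
    exact (Lp.coeFn_sub p.2 q.2).trans (h2.sub h4)

theorem integral_mul_eq_inner (R p : L2 Ω) {φ : Space d → ℝ} (hp : p =ᵐ[volume.restrict Ω] φ) :
    ∫ x in Ω, R x * φ x = inner ℝ R p := by
  rw [L2.inner_def]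
  refine integral_congr_ae ?_
  filter_upwards [hp] with x hx
  rw [hx]
  simp [mul_comm]

/-- Testing the equation for the difference of two functions with this difference. -/
theorem EllipticOperator.LowerBound.inner_add_le {L : EllipticOperator Ω} {μ : ℝ}
    (hL : L.LowerBound μ) {v v' R D : L2 Ω} {V V' : L2Vec Ω} (hv : (v, V) ∈ H10Graph Ω)
    (hv' : (v', V') ∈ H10Graph Ω)
    (h : ∀ (φ : Space d → ℝ) (p : L2 Ω), IsTestFunction Ω φ → p =ᵐ[volume.restrict Ω] φ →
      inner ℝ R p = inner ℝ D p + L.pairing v V φ (gradient φ) -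
        L.pairing v' V' φ (gradient φ)) :
    inner ℝ D (v - v') + μ * ‖v - v'‖ ^ 2 ≤ inner ℝ R (v - v') := by
  have hmem := sub_mem_H10Graph hv hv'
  have hlow := hL (v - v') (V - V') hmem
  rw [L.pairing_eq_inner (Lp.memLp (v - v')) (Lp.memLp (V - V')) (v - v') (V - V') .rfl .rfl,
    L.toLp_lowerPart_sub, L.toLp_flux_sub] at hlow
  set F := (L.memLp_lowerPart (Lp.memLp v) (Lp.memLp V)).toLp -
    (L.memLp_lowerPart (Lp.memLp v') (Lp.memLp V')).toLp with hF
  set G := (L.memLp_flux (Lp.memLp v) (Lp.memLp V)).toLp -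
    (L.memLp_flux (Lp.memLp v') (Lp.memLp V')).toLp with hG
  -- The weak identity is a closed condition that holds on test functions, hence on their closure
  -- `H10Graph Ω`, which contains the difference `(v - v', V - V')`.
  have hclosed : IsClosed {p : L2 Ω × L2Vec Ω |
      inner ℝ R p.1 = inner ℝ D p.1 + (inner ℝ F p.1 + inner ℝ G p.2)} :=
    isClosed_eq (by fun_prop) (by fun_prop)
  have hsub : H10Graph Ω ⊆ {p : L2 Ω × L2Vec Ω |
      inner ℝ R p.1 = inner ℝ D p.1 + (inner ℝ F p.1 + inner ℝ G p.2)} := by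
    refine closure_minimal ?_ hclosed
    rintro p ⟨φ, hφ, h1, h2⟩
    have := h φ p.1 hφ h1
    rw [L.pairing_eq_inner (Lp.memLp v) (Lp.memLp V) p.1 p.2 h1 h2,
      L.pairing_eq_inner (Lp.memLp v') (Lp.memLp V') p.1 p.2 h1 h2] at this
    simp only [mem_ofPred_eq, hF, hG, inner_sub_left]
    linarith
  have := hsub hmem
  simp only [mem_ofPred_eq, Prod.fst_sub, Prod.snd_sub] at this
  linarith

/-- The energy inequality for the error of an approximation with the modified residual `R`. -/
theorem IsModifiedResidual.exists_energy_le {L : EllipticOperator Ω} {α T μ : ℝ}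
    (hL : L.LowerBound μ) {f : ℝ → Space d → ℝ} {u₀ : L2 Ω} {u uh R : ℝ → L2 Ω}
    (hu : IsSolution Ω L α T f u₀ u) (hR : IsModifiedResidual Ω L α T f u₀ uh R) {t : ℝ}
    (ht : t ∈ Ioc 0 T) :
    ∃ w : L2 Ω, HasCaputoDerivAt α (fun s => uh s - u s) t w ∧
      inner ℝ (w + ((Real.Gamma (1 - α))⁻¹ * t ^ (-α)) • (uh 0 - u 0)) (uh t - u t) +
        μ * ‖uh t - u t‖ ^ 2 ≤ ‖R t‖ * ‖uh t - u t‖ := by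
  obtain ⟨hu0, hu⟩ := hu
  obtain ⟨U, Du, hU, hDu, hweak⟩ := hu t ht
  obtain ⟨Uh, Duh, hUh, hDuh, hweakh⟩ := hR t ht
  refine ⟨Duh - Du, hDuh.sub ht.1 hDu, ?_⟩
  refine (hL.inner_add_le (R := R t) hUh hU fun φ p hφ hp => ?_).trans (real_inner_le_norm _ _)
  have h1 := hweak φ hφ
  have h2 := hweakh φ hφ
  have h3 : ∫ x in Ω, (uh 0 x - u₀ x) * (Real.Gamma (1 - α))⁻¹ * t ^ (-α) * φ x =
      (Real.Gamma (1 - α))⁻¹ * t ^ (-α) * inner ℝ (uh 0 - u₀) p := by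
    rw [← integral_mul_eq_inner _ p hp, ← integral_const_mul]
    refine integral_congr_ae ?_
    filter_upwards [Lp.coeFn_sub (uh 0) u₀] with x hx
    rw [hx, Pi.sub_apply]
    ring
  rw [integral_mul_eq_inner _ p hp] at h1
  rw [integral_mul_eq_inner _ p hp, integral_mul_eq_inner _ p hp, h3] at h2
  -- With `u 0 = u₀` the correction in the residual is the multiple of `e(0)`; the terms with `f`
  -- cancel.
  rw [hu0, inner_add_left, inner_sub_left, real_inner_smul_left]
  linarith

end Elliptic

/-! ### The explicit residual barriers -/

/-- The whole derivative comes from the jump at `0`; together with `μ c` it gives `c` times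
`barrierR0`. -/
theorem hasCaputoDerivAt_step {α t : ℝ} (c : ℝ) :
    HasCaputoDerivAt α (fun s : ℝ => if 0 < s then c else 0) t
      ((Real.Gamma (1 - α))⁻¹ * t ^ (-α) * c) := by
  refine ⟨fun _ => 0, fun ε hε => ⟨⟨by simp, fun s hs => ?_⟩, by simp⟩, ?_⟩
  · simp [hε.1, hε.1.trans_le hs.1]
  · refine tendsto_const_nhds.congr' ?_
    filter_upwards [self_mem_nhdsWithin] with ε hε
    have : 0 < ε := hε
    simp [this, mul_assoc]

/-- The derivative of `max {τ, s} ^ (α - 1)`. -/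
noncomputable def barrierE1Deriv (α τ s : ℝ) : ℝ := if s < τ then 0 else (α - 1) * s ^ (α - 2)

theorem measurable_barrierE1Deriv {α τ : ℝ} : Measurable (barrierE1Deriv α τ) :=
  Measurable.ite measurableSet_Iio measurable_const (by fun_prop)

theorem norm_barrierE1Deriv_le {α τ s : ℝ} (hα1 : α < 1) (hτ : 0 < τ) :
    ‖barrierE1Deriv α τ s‖ ≤ (1 - α) * τ ^ (α - 2) := by
  have h1 : 0 < 1 - α := by linarith
  rw [barrierE1Deriv]
  split_ifs with h
  · rw [norm_zero]
    positivity
  · push Not at h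
    have hs : 0 < s := hτ.trans_le h
    rw [norm_mul, Real.norm_eq_abs, Real.norm_eq_abs, abs_of_neg (by linarith), neg_sub,
      abs_of_pos (by positivity)]
    exact mul_le_mul_of_nonneg_left (Real.rpow_le_rpow_of_nonpos hτ h (by linarith)) h1.le

theorem intervalIntegrable_mul_barrierE1Deriv {α τ a b : ℝ} {k : ℝ → ℝ} (hα1 : α < 1) (hτ : 0 < τ)
    (hk : IntervalIntegrable k volume a b) :
    IntervalIntegrable (fun s => k s * barrierE1Deriv α τ s) volume a b :=
  ⟨Integrable.mul_bdd hk.1 measurable_barrierE1Deriv.aestronglyMeasurable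
    (ae_of_all _ fun _ => norm_barrierE1Deriv_le hα1 hτ),
   Integrable.mul_bdd hk.2 measurable_barrierE1Deriv.aestronglyMeasurable
    (ae_of_all _ fun _ => norm_barrierE1Deriv_le hα1 hτ)⟩

theorem hasTimeDeriv_barrierE1 {α τ a b : ℝ} (hα1 : α < 1) (hτ : 0 < τ) :
    HasTimeDeriv (barrierE1 α τ) (barrierE1Deriv α τ) a b := by
  have hint : ∀ x y : ℝ, IntervalIntegrable (barrierE1Deriv α τ) volume x y := fun x y => by
    simpa using intervalIntegrable_mul_barrierE1Deriv (a := x) (b := y) (k := fun _ => 1) hα1 hτ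
      (by simp)
  refine ⟨hint a b, fun s hs => ?_⟩
  have hmax : ∀ x : ℝ, max τ x ≠ 0 := fun x => (hτ.trans_le (le_max_left τ x)).ne'
  have hcont : Continuous (barrierE1 α τ) :=
    (continuous_const.max continuous_id).rpow_const fun x => Or.inl (hmax x)
  -- One-sided derivatives suffice and are needed: at the kink `τ` the function `barrierE1Deriv`
  -- takes the right derivative.
  rw [intervalIntegral.integral_eq_sub_of_hasDeriv_right hcont.continuousOn (fun x _ => ?_)
    (hint a s)]
  · ring
  · rw [barrierE1Deriv]
    split_ifs with h
    · refine HasDerivAt.hasDerivWithinAt ?_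
      refine (hasDerivAt_const x (τ ^ (α - 1))).congr_of_eventuallyEq ?_
      filter_upwards [Iio_mem_nhds h] with y hy
      rw [barrierE1, max_eq_left (le_of_lt hy)]
    · push Not at h
      have hx : x ≠ 0 := (hτ.trans_le h).ne'
      have hd := (Real.hasDerivAt_rpow_const (p := α - 1) (Or.inl hx)).hasDerivWithinAt (s := Ioi x)
      rw [show α - 1 - 1 = α - 2 by ring] at hd
      refine hd.congr (fun y hy => ?_) ?_
      · rw [barrierE1, max_eq_right (h.trans (le_of_lt hy))]
      · rw [barrierE1, max_eq_right h]

/-- The integrand has the primitive `t⁻¹ (t - s)^{1-α} s^{α-1}`, which vanishes at `s = t`. -/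
theorem integral_sub_rpow_mul_rpow {α τ t : ℝ} (hα1 : α < 1) (hτ : 0 < τ) (hτt : τ < t) :
    ∫ s in τ..t, (t - s) ^ (-α) * ((α - 1) * s ^ (α - 2)) =
      -(t⁻¹ * ((t - τ) ^ (1 - α) * τ ^ (α - 1))) := by
  have ht : 0 < t := hτ.trans hτt
  have hpos : ∀ s ∈ Icc τ t, s ≠ 0 := fun s hs => (hτ.trans_le hs.1).ne'
  have hcont : ContinuousOn (fun s : ℝ => t⁻¹ * ((t - s) ^ (1 - α) * s ^ (α - 1))) (Icc τ t) := by
    refine continuousOn_const.mul (ContinuousOn.mul ?_ ?_)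
    · exact (continuousOn_const.sub continuousOn_id).rpow_const fun s _ => Or.inr (by linarith)
    · exact continuousOn_id.rpow_const fun s hs => Or.inl (hpos s hs)
  have hint : IntervalIntegrable (fun s => (t - s) ^ (-α) * ((α - 1) * s ^ (α - 2))) volume τ t := by
    refine (intervalIntegrable_sub_rpow (by linarith)).mul_continuousOn ?_
    rw [uIcc_of_le hτt.le]
    exact continuousOn_const.mul (continuousOn_id.rpow_const fun s hs => Or.inl (hpos s hs))
  rw [intervalIntegral.integral_eq_sub_of_hasDerivAt_of_le hτt.le hcont (fun s hs => ?_) hint]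
  · rw [sub_self, Real.zero_rpow (by linarith)]
    ring
  · have hs0 : 0 < s := hτ.trans hs.1
    have hts : 0 < t - s := sub_pos.2 hs.2
    have h1 := ((hasDerivAt_id s).const_sub t).rpow_const (p := 1 - α)
      (Or.inl (by simpa only [id] using hts.ne'))
    have h2 := Real.hasDerivAt_rpow_const (p := α - 1) (Or.inl hs0.ne')
    refine ((h1.mul h2).const_mul t⁻¹).congr_deriv ?_
    simp only [id]
    have e1 : (t - s) ^ (1 - α) = (t - s) ^ (-α) * (t - s) := by
      rw [← Real.rpow_add_one hts.ne']
      ring_nf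
    have e2 : s ^ (α - 1) = s ^ (α - 2) * s := by
      rw [← Real.rpow_add_one hs0.ne']
      ring_nf
    rw [show 1 - α - 1 = -α by ring, show α - 1 - 1 = α - 2 by ring, e1, e2]
    field_simp
    ring

/-- The jump `c τ^{α-1}` at `0` produces the term `1` in the bracket of `ρ`; the decay of `E₁` after
`τ` produces the term `-((1 - τ/t)^+)^β`. -/
theorem hasCaputoDerivAt_barrierE1 {α τ t : ℝ} (c : ℝ) (hα1 : α < 1) (hτ : 0 < τ) (ht : 0 < t) :
    HasCaputoDerivAt α (fun s : ℝ => if 0 < s then c * barrierE1 α τ s else 0) t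
      (c * ((Real.Gamma (1 - α))⁻¹ * t⁻¹ * barrierRho α (τ / t))) := by
  refine ⟨fun s => c * barrierE1Deriv α τ s, fun ε hε => ⟨?_, ?_⟩, ?_⟩
  · obtain ⟨h1, h2⟩ := hasTimeDeriv_barrierE1 (a := ε) (b := t) hα1 hτ
    refine ⟨h1.const_mul c, fun s hs => ?_⟩
    simp only [hε.1, hε.1.trans_le hs.1, if_true]
    rw [intervalIntegral.integral_const_mul, ← mul_add, ← h2 s hs]
  · refine ((intervalIntegrable_mul_barrierE1Deriv hα1 hτ
      (intervalIntegrable_sub_rpow (a := ε) (t := t) (p := -α) (by linarith))).const_mul c).congr fun s _ => ?_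
    simp only [smul_eq_mul]
    ring
  · refine tendsto_const_nhds.congr' ?_
    filter_upwards [Ioo_mem_nhdsGT (lt_min hτ ht)] with ε hε
    have hετ : ε < τ := hε.2.trans_le (min_le_left _ _)
    have hεt : ε < t := hε.2.trans_le (min_le_right _ _)
    have hint : ∀ x y : ℝ, x ≤ y → y ≤ t → IntervalIntegrable
        (fun s => (t - s) ^ (-α) * barrierE1Deriv α τ s) volume x y := fun x y hxy hyt =>
      (intervalIntegrable_mul_barrierE1Deriv hα1 hτ
        (intervalIntegrable_sub_rpow (a := x) (t := t) (p := -α) (by linarith))).mono_set (by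
          rw [uIcc_of_le hxy, uIcc_of_le (hxy.trans hyt)]
          exact Icc_subset_Icc_right hyt)
    have hzero : ∀ y, ε ≤ y → y ≤ τ → ∫ s in ε..y, (t - s) ^ (-α) * barrierE1Deriv α τ s = 0 := by
      intro y hεy hyτ
      refine intervalIntegral.integral_zero_ae ?_
      filter_upwards [show ∀ᵐ r : ℝ, r ≠ y by simp [ae_iff, measure_singleton]] with r hr hr'
      rw [uIoc_of_le hεy] at hr'
      rw [barrierE1Deriv, if_pos ((lt_of_le_of_ne hr'.2 hr).trans_le hyτ), mul_zero]
    have hpow : t⁻¹ * (τ / t) ^ (-(1 - α)) = t ^ (-α) * τ ^ (α - 1) := by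
      rw [neg_sub, Real.div_rpow hτ.le ht.le, show -α = -1 - (α - 1) by ring,
        Real.rpow_sub ht (-1), Real.rpow_neg_one]
      ring
    have hmain : t ^ (-α) * τ ^ (α - 1) + ∫ s in ε..t, (t - s) ^ (-α) * barrierE1Deriv α τ s =
        t⁻¹ * barrierRho α (τ / t) := by
      rw [barrierRho, ← mul_assoc, hpow]
      rcases le_or_gt t τ with h | h
      · have : 1 - τ / t ≤ 0 := sub_nonpos.2 ((one_le_div ht).2 h)
        rw [hzero t hεt.le h, max_eq_left this, Real.zero_rpow (by linarith)]
        ring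
      · have h1 : 1 - τ / t = (t - τ) / t := by field_simp
        have h2 : ∫ s in τ..t, (t - s) ^ (-α) * barrierE1Deriv α τ s =
            ∫ s in τ..t, (t - s) ^ (-α) * ((α - 1) * s ^ (α - 2)) := by
          refine intervalIntegral.integral_congr fun s hs => ?_
          rw [uIcc_of_le h.le] at hs
          simp only [barrierE1Deriv, if_neg (not_lt.2 hs.1)]
        have h3 : t ^ (-α) = t⁻¹ * t ^ (1 - α) := by
          rw [← Real.rpow_neg_one, ← Real.rpow_add ht]
          ring_nf
        rw [← intervalIntegral.integral_add_adjacent_intervals (hint ε τ hετ.le h.le)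
          (hint τ t h.le le_rfl), hzero τ hετ.le le_rfl, h2, integral_sub_rpow_mul_rpow hα1 hτ h,
          h1, max_eq_right (div_nonneg (by linarith) ht.le),
          Real.div_rpow (by linarith) ht.le, h3]
        have := (Real.rpow_pos_of_pos ht (1 - α)).ne'
        field_simp
        ring
    simp only [hε.1, lt_irrefl, if_true, if_false, sub_zero, smul_eq_mul]
    rw [barrierE1, max_eq_left hετ.le]
    simp_rw [mul_left_comm _ c]
    rw [intervalIntegral.integral_const_mul, ← mul_add, hmain]
    ring

theorem rpow_mul_min_le_barrierRho {α s : ℝ} (hα0 : 0 < α) (hα1 : α < 1) (hs : 0 < s) :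
    s ^ (-(1 - α)) * min ((1 - α) * s) 1 ≤ barrierRho α s := by
  rw [barrierRho]
  refine mul_le_mul_of_nonneg_left ?_ (Real.rpow_nonneg hs.le _)
  rcases le_or_gt 1 s with h | h
  · rw [max_eq_left (by linarith), Real.zero_rpow (by linarith), sub_zero]
    exact min_le_right _ _
  · rw [max_eq_right (by linarith)]
    -- Bernoulli's inequality for exponents in `[0, 1]`: `(1 - s)^β ≤ 1 - β s`.
    have := rpow_one_add_le_one_add_mul_self (s := -s) (by linarith) (p := 1 - α) (by linarith)
      (by linarith)
    rw [← sub_eq_add_neg] at this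
    exact (min_le_left _ _).trans (by linarith)

theorem barrierE1_pos {α τ t : ℝ} (hτ : 0 < τ) : 0 < barrierE1 α τ t :=
  Real.rpow_pos_of_pos (lt_max_of_lt_left hτ) _

theorem barrierE1_le {α τ t : ℝ} (hα1 : α < 1) (ht : 0 < t) : barrierE1 α τ t ≤ t ^ (α - 1) :=
  Real.rpow_le_rpow_of_nonpos ht (le_max_right _ _) (by linarith)

theorem barrierR0_pos {α μ t : ℝ} (hα1 : α < 1) (hμ : 0 ≤ μ) (ht : 0 < t) :
    0 < barrierR0 α μ t := by
  have := Real.Gamma_pos_of_pos (sub_pos.2 hα1)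
  rw [barrierR0]
  positivity

theorem barrierR1_pos {α μ τ t : ℝ} (hα0 : 0 < α) (hα1 : α < 1) (hμ : 0 ≤ μ) (hτ : 0 < τ)
    (ht : 0 < t) : 0 < barrierR1 α μ τ t := by
  have h1 := Real.Gamma_pos_of_pos (sub_pos.2 hα1)
  have h2 : 0 < barrierRho α (τ / t) := by
    refine lt_of_lt_of_le ?_ (rpow_mul_min_le_barrierRho hα0 hα1 (div_pos hτ ht))
    have : 0 < 1 - α := by linarith
    have : 0 < min ((1 - α) * (τ / t)) 1 := lt_min (by positivity) one_pos
    positivity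
  have h3 := barrierE1_pos (α := α) (t := t) hτ
  rw [barrierR1]
  positivity

/-- An infinite supremum makes the bound trivial; a finite one is itself an admissible constant `c`.
-/
theorem ofReal_le_mul_iSup {S : Set ℝ} {r b : ℝ → ℝ} {x A : ℝ} (hA : 0 < A)
    (hb : ∀ s ∈ S, 0 < b s) (h : ∀ c, 0 ≤ c → (∀ s ∈ S, r s ≤ c * b s) → x ≤ A * c) :
    ENNReal.ofReal x ≤ ENNReal.ofReal A * ⨆ s ∈ S, ENNReal.ofReal (r s / b s) := by
  set M := ⨆ s ∈ S, ENNReal.ofReal (r s / b s) with hM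
  by_cases htop : M = ⊤
  · rw [htop, ENNReal.mul_top (by simpa using hA)]
    exact le_top
  · rw [← ENNReal.ofReal_toReal htop, ← ENNReal.ofReal_mul hA.le]
    refine ENNReal.ofReal_le_ofReal (h _ ENNReal.toReal_nonneg fun s hs => ?_)
    rw [← div_le_iff₀ (hb s hs), ← ENNReal.ofReal_le_iff_le_toReal htop]
    exact le_iSup₂ (f := fun s _ => ENNReal.ofReal (r s / b s)) s hs

end FracParabolic

/-! ### The main theorem -/

open FracParabolic in
theorem corollary3 {d : ℕ} (Ω : Set (Space d)) (hΩ : IsOpen Ω)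
    (L : EllipticOperator Ω) (α T μ : ℝ) (hα0 : 0 < α) (hα1 : α < 1) (hT : 0 < T)
    (hL : L.LowerBound μ)
    (f : ℝ → Space d → ℝ) (hf : ∀ t ∈ Ioc 0 T, LocallyIntegrableOn (f t) Ω)
    (u₀ : L2 Ω) (u uh R : ℝ → L2 Ω)
    (hu_reg : TimeRegular T u) (huh_reg : TimeRegular T uh)
    (hu : IsSolution Ω L α T f u₀ u)
    (huh_cont : ContinuousOn uh (Icc 0 T))
    (hR : IsModifiedResidual Ω L α T f u₀ uh R) :
    -- the error bound through the inverse of the fractional operator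
    (∀ t ∈ Ioc 0 T, ‖uh t - u t‖ₑ ≤ caputoInv α μ (fun s => ‖R s‖ₑ) t) ∧
    -- the error bound through a barrier function
    (∀ B DB : ℝ → ℝ, (∀ t ∈ Icc 0 T, 0 ≤ B t) →
      (∀ t ∈ Ioc 0 T, HasCaputoDerivAt α B t (DB t)) →
      (∀ t ∈ Ioc 0 T, ‖R t‖ ≤ DB t + μ * B t) →
      (∀ t ∈ Ioc 0 T, ‖uh t - u t‖ ≤ B t) ∧
      (ContinuousWithinAt B (Ici 0) 0 → ContinuousWithinAt u (Ici 0) 0 →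
        ‖uh 0 - u 0‖ ≤ B 0)) ∧
    -- the error bounds for the two explicit residual barriers
    (0 ≤ μ → ∀ τ : ℝ, 0 < τ →
      (∀ t ∈ Ioc 0 T,
        ‖uh t - u t‖ₑ ≤ (⨆ s ∈ Ioc 0 t, ENNReal.ofReal (‖R s‖ / barrierR0 α μ s)) ∧
        ‖uh t - u t‖ₑ ≤ ENNReal.ofReal (t ^ (α - 1)) *
          (⨆ s ∈ Ioc 0 t, ENNReal.ofReal (‖R s‖ / barrierR1 α μ τ s)) ∧
        ‖uh t - u t‖ₑ ≤ ENNReal.ofReal (barrierE1 α τ t) *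
          (⨆ s ∈ Ioc 0 t, ENNReal.ofReal (‖R s‖ / barrierR1 α μ τ s))) ∧
      (∀ s : ℝ, 0 < s →
        s ^ (-(1 - α)) * min ((1 - α) * s) 1 ≤ barrierRho α s)) := by
  obtain ⟨C, hC0, hC⟩ := (huh_reg.sub hu_reg).exists_bound hT
  have hd : ∀ t ∈ Ioc 0 T, ∀ ε ∈ Ioo 0 t, HasTimeDeriv (fun r => ‖uh r - u r‖)
      (deriv fun r => ‖uh r - u r‖) ε t := by
    intro t ht ε hε
    obtain ⟨K, hK⟩ := ((huh_reg.sub hu_reg) ε t hε.1 hε.2 ht.2).2.exists_lipschitzOnWith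
    exact (lipschitzWith_one_norm.comp_lipschitzOnWith hK).hasTimeDeriv_deriv hε.2.le
  have hop : ∀ t ∈ Ioc 0 T, ∀ ε ∈ Ioo 0 t, ∀ s ∈ Ioo ε t,
      truncatedOp α μ (fun r => ‖uh r - u r‖) (deriv fun r => ‖uh r - u r‖) ε s ≤
        ‖R s‖ + C * (resolventSymbol α μ (s - ε) - resolventSymbol α μ s) := by
    intro t ht ε hε s hs
    have hsT : s ≤ T := hs.2.le.trans ht.2
    obtain ⟨w, hw, henergy⟩ := hR.exists_energy_le hL hu ⟨hε.1.trans hs.1, hsT⟩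
    exact truncatedOp_norm_le hα0 hα1 (huh_reg.sub hu_reg) hC hε.1 hs.1 hsT (norm_nonneg _) hw
      henergy
  -- The barrier is only needed up to the current `t`, so it may contain a supremum over `(0, t]`.
  have hcmp : ∀ t ∈ Ioc 0 T, ∀ B DB : ℝ → ℝ, (∀ s ∈ Icc 0 t, 0 ≤ B s) →
      (∀ s ∈ Ioc 0 t, HasCaputoDerivAt α B s (DB s)) →
      (∀ s ∈ Ioo 0 t, ‖R s‖ ≤ DB s + μ * B s) → ‖uh t - u t‖ ≤ B t :=
    fun t ht B DB hB0 hB hρ =>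
      le_of_le_caputo_barrier hα0 hα1 ht.1 (hd t ht) (hop t ht) hB0 hB hρ
  refine ⟨fun t ht => ?_, fun B DB hB0 hB hρ => ?_, fun hμ τ hτ => ⟨fun t ht => ?_, fun s hs =>
    rpow_mul_min_le_barrierRho hα0 hα1 hs⟩⟩
  · have h := ofReal_le_caputoInv hα0 hα1 ht.1 hC0 (hd t ht) (hop t ht)
    simpa only [ofReal_norm] using h
  · have hle : ∀ t ∈ Ioc 0 T, ‖uh t - u t‖ ≤ B t := fun t ht =>
      hcmp t ht B DB (fun s hs => hB0 s ⟨hs.1, hs.2.trans ht.2⟩)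
        (fun s hs => hB s ⟨hs.1, hs.2.trans ht.2⟩)
        (fun s hs => hρ s ⟨hs.1, hs.2.le.trans ht.2⟩)
    refine ⟨hle, fun hBc huc => ?_⟩
    have h1 : Tendsto uh (𝓝[>] 0) (𝓝 (uh 0)) := by
      refine (huh_cont 0 ⟨le_rfl, hT.le⟩).tendsto.mono_left ?_
      rw [← nhdsWithin_Ioo_eq_nhdsGT hT]
      exact nhdsWithin_mono _ Ioo_subset_Icc_self
    have h2 : Tendsto u (𝓝[>] 0) (𝓝 (u 0)) :=
      huc.tendsto.mono_left (nhdsWithin_mono _ Ioi_subset_Ici_self)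
    have h3 : Tendsto B (𝓝[>] 0) (𝓝 (B 0)) :=
      hBc.tendsto.mono_left (nhdsWithin_mono _ Ioi_subset_Ici_self)
    refine le_of_tendsto_of_tendsto (h1.sub h2).norm h3 ?_
    filter_upwards [Ioo_mem_nhdsGT hT] with t ht
    exact hle t ⟨ht.1, ht.2.le⟩
  · have hE1 : ‖uh t - u t‖ₑ ≤ ENNReal.ofReal (barrierE1 α τ t) *
        (⨆ s ∈ Ioc 0 t, ENNReal.ofReal (‖R s‖ / barrierR1 α μ τ s)) := by
      rw [← ofReal_norm]
      refine ofReal_le_mul_iSup (barrierE1_pos hτ)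
        (fun s hs => barrierR1_pos hα0 hα1 hμ hτ hs.1) fun c hc hle => ?_
      -- The value `0` at `s = 0` creates the jump that contributes to the Caputo derivative.
      have h := hcmp t ht (fun s => if 0 < s then c * barrierE1 α τ s else 0)
        (fun s => c * ((Real.Gamma (1 - α))⁻¹ * s⁻¹ * barrierRho α (τ / s))) (fun s _ => ?_)
        (fun s hs => hasCaputoDerivAt_barrierE1 c hα1 hτ hs.1) (fun s hs => ?_)
      · simpa only [ht.1, if_true, mul_comm c] using h
      · split_ifs
        · exact mul_nonneg hc (barrierE1_pos hτ).le
        · exact le_rfl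
      · simp only [hs.1, if_true]
        refine (hle s ⟨hs.1, hs.2.le⟩).trans (le_of_eq ?_)
        rw [barrierR1]
        ring
    refine ⟨?_, hE1.trans ?_, hE1⟩
    · rw [← ofReal_norm, ← one_mul (⨆ s ∈ Ioc 0 t, _), ← ENNReal.ofReal_one]
      refine ofReal_le_mul_iSup one_pos (fun s hs => barrierR0_pos hα1 hμ hs.1) fun c hc hle => ?_
      have h := hcmp t ht (fun s => if 0 < s then c else 0)
        (fun s => (Real.Gamma (1 - α))⁻¹ * s ^ (-α) * c) (fun s _ => ?_)
        (fun _ _ => hasCaputoDerivAt_step c) (fun s hs => ?_)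
      · simpa only [ht.1, if_true, one_mul] using h
      · split_ifs
        · exact hc
        · exact le_rfl
      · simp only [hs.1, if_true]
        refine (hle s ⟨hs.1, hs.2.le⟩).trans (le_of_eq ?_)
        rw [barrierR0]
        ring
    · gcongr
      exact barrierE1_le hα1 ht.1
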